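/- Let $J\ge 1$, $c>0$, $r_1,\dots,r_J>0$, and let $B_0$ be a finite, nonzero, continuous (atomless) Borel measure on a complete separable metric space $\Omega$; put $\gamma_0=B_0(\Omega)$ and $r_{\cdot}=\sum_j r_j$. Consider the group-size dependent mixed-membership model governed by the beta-negative binomial process (BNBP): $B=\sum_{k}p_k\delta_{\omega_k}\sim\mathrm{BP}(c,B_0)$ is a beta process, i.e. the points $(p_k,\omega_k)_{k\ge 1}$ form a Poisson point process on $(0,1)\times\Omega$ with intensity $\nu(dp\,d\omega)=p^{-1}(1-p)^{c-1}\,dp\,B_0(d\omega)$; given $B$, the weights $\theta_{jk}$ ($1\le j\le J$, $k\ge1$) are independent, $\theta_{jk}\sim\mathrm{Gamma}(r_j,\ \text{scale }p_k/(1-p_k))$; given $B$ and the $\theta_{jk}$, the group sizes $m_j\sim\mathrm{Pois}(\sum_k\theta_{jk})$ and the labels $z_{ji}$, with $P(z_{ji}=k)=\theta_{jk}/\sum_{l}\theta_{jl}$, are all independent. Group $j$ consists of the data points $(j,i)$, $1\le i\le m_j$, and the labels partition all data points into clusters of points with equal label. Let $\boldsymbol m=(m_1,\dots,m_J)\in\{0,1,2,\dots\}^J$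 be a fixed vector of group sizes with $m_{\cdot}=\sum_j m_j\ge 1$. For $K\ge1$ let $\sum_{\sum_{k=1}^{K}\boldsymbol n_{:k}=\boldsymbol m}$ denote summation over all ordered $K$-tuples of count vectors $\boldsymbol n_{:k}=(n_{1k},\dots,n_{Jk})\in\{0,1,2,\dots\}^J$ with $\sum_{k=1}^K\boldsymbol n_{:k}=\boldsymbol m$ and $n_{\cdot k}:=\sum_j n_{jk}\ge1$ for every $k$, and let $$D(\boldsymbol m)=\sum_{K'=1}^{m_{\cdot}}\frac{\gamma_0^{K'}}{K'!}\sum_{\sum_{k'=1}^{K'}\boldsymbol n_{:k'}=\boldsymbol m}\ \prod_{k'=1}^{K'}\left[\frac{\Gamma(n_{\cdot k'})\Gamma(c+r_{\cdot})}{\Gamma(c+n_{\cdot k'}+r_{\cdot})}\prod_{j=1}^J\frac{\Gamma(n_{jk'}+r_j)}{n_{jk'}!\,\Gamma(r_j)}\right].$$ Then, with $\psi=\Gamma'/\Gamma$: (i) the group sizes equal $\boldsymbol m$ with the positive probability $f(\boldsymbol m\mid\boldsymbol r,\gamma_0,c)=e^{-\gamma_0[\psi(c+r_{\cdot})-\psi(c)]}\,D(\boldsymbol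 m)$; (ii) given that the group sizes equal $\boldsymbol m$, the conditional probability that the partition into clusters is a given partition $\boldsymbol z$ of the $m_{\cdot}$ data points, with $K_J$ clusters of which the $k$-th has $n_{jk}$ points in group $j$, is $$f(\boldsymbol z\mid\boldsymbol m,\boldsymbol r,\gamma_0,c)=\frac{1}{D(\boldsymbol m)}\cdot\frac{\gamma_0^{K_J}}{\prod_{j=1}^Jm_j!}\prod_{k=1}^{K_J}\left[\frac{\Gamma(n_{\cdot k})\Gamma(c+r_{\cdot})}{\Gamma(c+n_{\cdot k}+r_{\cdot})}\prod_{j=1}^J\frac{\Gamma(n_{jk}+r_j)}{\Gamma(r_j)}\right];$$ (iii) this conditional probability depends only on the cluster sizes, regardless of their order: two partitions whose clusters have the same count vectors $(n_{1k},\dots,n_{Jk})$, counted with multiplicity and in any order, have the same conditional probability. -/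

import Mathlib

open MeasureTheory ProbabilityTheory

noncomputable section

namespace BNBP

/-- The Lévy measure `ν(dp dω) = p⁻¹ (1 - p) ^ (c - 1) dp B₀(dω)` of the beta process
`BP(c, B₀)`, carried by `(0, 1) × Ω`. -/
def betaLevy {Ω : Type*} [MeasurableSpace Ω] (c : ℝ) (B₀ : Measure Ω) : Measure (ℝ × Ω) :=
  ((volume.restrict (Set.Ioo (0 : ℝ) 1)).withDensity
    (fun p => ENNReal.ofReal (p⁻¹ * (1 - p) ^ (c - 1)))).prod B₀

/-- The random points `x 0, x 1, …` form a Poisson point process with intensity `ν`: the numbers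
of points in disjoint measurable sets of finite intensity are independent Poisson variables. -/
structure IsPoissonProcess {S E : Type*} [MeasurableSpace S] [MeasurableSpace E]
    (P : Measure S) (x : ℕ → S → E) (ν : Measure E) : Prop where
  measurable : ∀ k, Measurable (x k)
  counts : ∀ (N : ℕ) (A : Fin N → Set E), (∀ i, MeasurableSet (A i)) → (∀ i, ν (A i) ≠ ⊤) →
    Pairwise (fun i i' => Disjoint (A i) (A i')) → ∀ q : Fin N → ℕ,
      P {s | ∀ i, {k | x k s ∈ A i}.encard = (q i : ℕ∞)} =
        ∏ i, poissonMeasure (ν (A i)).toNNReal {q i}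

/-- Given `X`, the variables `Y i` are conditionally independent and `Y i` has the conditional
distribution `κ i X`. -/
def CondIndepWithLaw {S X' Y' ι : Type*} [MeasurableSpace S] [MeasurableSpace X']
    [MeasurableSpace Y'] (P : Measure S) (X : S → X') (Y : ι → S → Y')
    (κ : ι → X' → Measure Y') : Prop :=
  ∀ (F : Finset ι) (E : Set X') (A : ι → Set Y'), MeasurableSet E → (∀ i, MeasurableSet (A i)) →
    P {s | X s ∈ E ∧ ∀ i ∈ F, Y i s ∈ A i} = ∫⁻ s in X ⁻¹' E, ∏ i ∈ F, κ i (X s) (A i) ∂P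

/-- The distribution `∑ k, (t k / ∑ l, t l) δ_k` on the labels `k`. -/
def categorical (t : ℕ → ℝ) : Measure ℕ :=
  Measure.sum fun k => ENNReal.ofReal (t k / ∑' l, t l) • Measure.dirac k

/-- The group-size dependent mixed-membership model governed by the beta-negative binomial
process, with `J` groups, dispersion parameters `r`, concentration `c` and base measure `B₀`:
* `atom k = (p k, ω k)` are the atoms of the beta process `B = ∑ k, p k • δ_(ω k)`;
* `θ j k` are the weights of the gamma process `Θ j = ∑ k, θ j k • δ_(ω k)`; given `B` they are
  independent, gamma distributed with shape `r j` and scale `p k / (1 - p k)`, that is, rate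
  `(1 - p k) / p k`;
* given `B` and all `Θ j`, the group sizes `m j` and the labels `z j i` are independent, `m j` is
  Poisson with mean `Θ j (Ω) = ∑ k, θ j k`, and `z j i = k` with probability `θ j k / Θ j (Ω)`.
Group `j` consists of the data points `i < m j`. -/
structure IsModel {S Ω : Type*} [MeasurableSpace S] [MeasurableSpace Ω] {J : ℕ}
    (P : Measure S) (r : Fin J → ℝ) (c : ℝ) (B₀ : Measure Ω)
    (atom : ℕ → S → ℝ × Ω) (θ : Fin J → ℕ → S → ℝ) (m : Fin J → S → ℕ)
    (z : Fin J → ℕ → S → ℕ) : Prop where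
  beta_process : IsPoissonProcess P atom (betaLevy c B₀)
  measurable_weight : ∀ j k, Measurable (θ j k)
  measurable_size : ∀ j, Measurable (m j)
  measurable_label : ∀ j i, Measurable (z j i)
  gamma_process : CondIndepWithLaw P (fun s k => atom k s)
    (fun jk : Fin J × ℕ => θ jk.1 jk.2)
    (fun jk a => gammaMeasure (r jk.1) ((1 - (a jk.2).1) / (a jk.2).1))
  data : CondIndepWithLaw P (fun s => ((fun k => atom k s), (fun j k => θ j k s)))
    (Sum.elim m (fun ji : Fin J × ℕ => z ji.1 ji.2))
    (Sum.elim (fun j x => poissonMeasure (∑' k, x.2 j k).toNNReal)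
      (fun ji x => categorical (x.2 ji.1)))

/-- The data points `(j, i)`, `i < n j`, when the group sizes are `n`. -/
abbrev DataPoint {J : ℕ} (n : Fin J → ℕ) : Type := (j : Fin J) × Fin (n j)

open Classical in
/-- The partition of the data points into clusters of points with the same label. -/
def clusters {J : ℕ} (n : Fin J → ℕ) (label : DataPoint n → ℕ) :
    Finpartition (Finset.univ : Finset (DataPoint n)) :=
  Finpartition.ofSetoid (Setoid.ker label)

/-- The count vector `(n_{1k}, …, n_{Jk})` of a cluster: the number of its points in each group. -/
def clusterSize {J : ℕ} {n : Fin J → ℕ} (A : Finset (DataPoint n)) (j : Fin J) : ℕ :=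
  (A.filter fun x => x.1 = j).card

/-- `Γ(v.) Γ(c + r.) / Γ(c + v. + r.)`, where a dot denotes summation over the groups. -/
def columnTotalWeight {J : ℕ} (r : Fin J → ℝ) (c : ℝ) (v : Fin J → ℕ) : ℝ :=
  Real.Gamma (∑ j, (v j : ℝ)) * Real.Gamma (c + ∑ j, r j) /
    Real.Gamma (c + ∑ j, (v j : ℝ) + ∑ j, r j)

/-- The numerator of the exchangeable partition probability function. -/
def eppfNumerator {J : ℕ} (r : Fin J → ℝ) (c γ₀ : ℝ) (n : Fin J → ℕ)
    (π : Finpartition (Finset.univ : Finset (DataPoint n))) : ℝ :=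
  γ₀ ^ π.parts.card / (∏ j, ((n j).factorial : ℝ)) *
    ∏ A ∈ π.parts, (columnTotalWeight r c (clusterSize A) *
      ∏ j, Real.Gamma (clusterSize A j + r j) / Real.Gamma (r j))

/-- The ordered decompositions of the count vector `n` into `K` nonzero count vectors. -/
def decompositions {J : ℕ} (n : Fin J → ℕ) (K : ℕ) : Finset (Fin K → Fin J → ℕ) :=
  (Fintype.piFinset fun _ : Fin K => Finset.Iic n).filter
    fun v => (∑ k, v k = n) ∧ ∀ k, 1 ≤ ∑ j, v k j

/-- The denominator of the exchangeable partition probability function. -/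
def eppfDenominator {J : ℕ} (r : Fin J → ℝ) (c γ₀ : ℝ) (n : Fin J → ℕ) : ℝ :=
  ∑ K ∈ Finset.Icc 1 (∑ j, n j), γ₀ ^ K / (K.factorial : ℝ) *
    ∑ v ∈ decompositions n K, ∏ k, (columnTotalWeight r c (v k) *
      ∏ j, Real.Gamma (v k j + r j) / ((v k j).factorial * Real.Gamma (r j)))

/-- The digamma function on the reals. -/
def digamma (x : ℝ) : ℝ := logDeriv Real.Gamma x

end BNBP

end

/-!
Condition on the atoms `(p k, ω k)` of the beta process. Given the weights, the Poisson group
sizes and the categorical labels turn into independent Poisson counts of each label in each group,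
and integrating out the gamma weights makes these counts negative binomial. The probability of a
labelling is therefore an integral over the atoms of `∏ p k ^ n_{·k}` over the used labels times
`∏ (1 - p k) ^ r_·` over all `k`. A partition arises from the labellings given by the embeddings
of its clusters into `ℕ`; summing over them, the multivariate Campbell (Slivnyak–Mecke) formula
splits the integral into one beta integral per cluster and the void probability
`exp (-∫ (1 - (1 - p) ^ r_·) dν) = exp (-γ₀ (ψ (c + r_·) - ψ c))`. Summing over the partitions
gives the law of the group sizes: for each number `K` of clusters, the sum over the partitions and
the sum over the ordered decompositions of the count vector both count the surjective labellings
of the data points by `K` labels.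
-/

noncomputable section

namespace BNBP

open scoped ENNReal NNReal Topology
open Filter Finset

/-! ### Limits of series and products of extended nonnegative reals -/

lemma tendsto_tsum_of_monotone {α : Type*} {f : ℕ → α → ℝ≥0∞} {F : α → ℝ≥0∞}
    (hmono : ∀ a, Monotone fun n => f n a) (hf : ∀ a, Tendsto (fun n => f n a) atTop (𝓝 (F a))) :
    Tendsto (fun n => ∑' a, f n a) atTop (𝓝 (∑' a, F a)) := by
  let _ : MeasurableSpace α := ⊤
  simp_rw [← lintegral_count]
  exact lintegral_tendsto_of_tendsto_of_monotone (fun n => measurable_from_top.aemeasurable)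
    (Eventually.of_forall hmono) (Eventually.of_forall hf)

lemma tprod_le_one {α : Type*} {f : α → ℝ≥0∞} (h : ∀ a, f a ≤ 1) : ∏' a, f a ≤ 1 := by
  rw [ENNReal.tprod_eq_iInf_prod h]
  exact iInf_le_of_le ∅ (by simp)

lemma tendsto_tprod_of_antitone {α : Type*} {f : ℕ → α → ℝ≥0∞} {F : α → ℝ≥0∞}
    (hanti : ∀ a, Antitone fun n => f n a) (h1 : ∀ n a, f n a ≤ 1)
    (hf : ∀ a, Tendsto (fun n => f n a) atTop (𝓝 (F a))) :
    Tendsto (fun n => ∏' a, f n a) atTop (𝓝 (∏' a, F a)) := by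
  have hF1 (a : α) : F a ≤ 1 := le_of_tendsto' (hf a) fun n => h1 n a
  have hanti' (s : Finset α) : Antitone fun n => ∏ a ∈ s, f n a := fun _ _ h =>
    prod_le_prod' fun a _ => hanti a h
  have hprod (s : Finset α) : ∏ a ∈ s, F a = ⨅ n, ∏ a ∈ s, f n a :=
    tendsto_nhds_unique (ENNReal.tendsto_finsetProd_of_ne_top s (fun a _ => hf a)
      fun a _ => ((hF1 a).trans_lt ENNReal.one_lt_top).ne) (tendsto_atTop_iInf (hanti' s))
  have hinf : ∏' a, F a = ⨅ n, ∏' a, f n a := by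
    simp_rw [ENNReal.tprod_eq_iInf_prod hF1, ENNReal.tprod_eq_iInf_prod (h1 _), hprod]
    exact iInf_comm
  rw [hinf]
  refine tendsto_atTop_iInf fun n n' h => ?_
  simp only [ENNReal.tprod_eq_iInf_prod (h1 _)]
  exact iInf_mono fun s => hanti' s h

lemma tprod_mul_of_eq_one_off_finset {α : Type*} {a b : α → ℝ≥0∞} (s : Finset α)
    (ha : ∀ k ∉ s, a k = 1) (hat : ∀ k ∈ s, a k ≠ ⊤) (hb : ∀ k, b k ≤ 1) :
    ∏' k, a k * b k = (∏ k ∈ s, a k) * ∏' k, b k := by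
  refine HasProd.tprod_eq ?_
  have hlim : Tendsto (fun t : Finset α => (∏ k ∈ s, a k) * ∏ k ∈ t, b k) atTop
      (𝓝 ((∏ k ∈ s, a k) * ∏' k, b k)) :=
    ENNReal.Tendsto.const_mul (ENNReal.multipliable_of_le_one hb).hasProd
      (Or.inr (ENNReal.prod_ne_top hat))
  refine hlim.congr' ?_
  filter_upwards [eventually_ge_atTop s] with t hst
  rw [prod_mul_distrib, prod_subset hst fun k _ => ha k]

lemma measurable_tprod {α S : Type*} [MeasurableSpace S] [Countable α] {f : α → S → ℝ≥0∞}
    (hf : ∀ k, Measurable (f k)) (h1 : ∀ k s, f k s ≤ 1) : Measurable fun s => ∏' k, f k s := by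
  simp_rw [fun s => ENNReal.tprod_eq_iInf_prod fun k => h1 k s]
  exact Measurable.iInf fun F => measurable_fun_prod _ fun k _ => hf k

/-! ### Counting injections with prescribed values -/

/-- Injections of a disjoint union that send the part `t` into `A t`, for disjoint sets `A t`. -/
def sigmaEmbeddingEquiv {T L : Type*} {I : T → Type*} (A : T → Set L)
    (hA : Pairwise (Function.onFun Disjoint A)) :
    {e : (Σ t, I t) ↪ L // ∀ i, e i ∈ A i.1} ≃ ∀ t, I t ↪ A t where
  toFun e t := ⟨fun i => ⟨e.1 ⟨t, i⟩, e.2 ⟨t, i⟩⟩, fun i i' h => by simpa using h⟩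
  invFun h := ⟨⟨fun i => h i.1 i.2, by
    rintro ⟨t, i⟩ ⟨t', i'⟩ (heq : (h t i : L) = h t' i')
    obtain rfl : t = t' := hA.eq (Set.not_disjoint_iff.2 ⟨_, (h t i).2, heq ▸ (h t' i').2⟩)
    rw [(h t).injective (Subtype.ext heq)]⟩, fun i => (h i.1 i.2).2⟩
  left_inv _ := rfl
  right_inv _ := rfl

lemma tsum_embedding_indicator {I T L : Type*} [Fintype I] [Fintype T] [DecidableEq T] (c : I → T)
    (A : T → Set L) (hA : Pairwise (Function.onFun Disjoint A)) (hfin : ∀ t, (A t).Finite) :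
    ∑' e : I ↪ L, ∏ i, (A (c i)).indicator (1 : L → ℝ≥0∞) (e i) =
      ∏ t, ((A t).ncard.descFactorial (Fintype.card {i // c i = t}) : ℝ≥0∞) := by
  classical
  have (t : T) : Fintype (A t) := (hfin t).fintype
  have hind (e : I ↪ L) : ∏ i, (A (c i)).indicator (1 : L → ℝ≥0∞) (e i) =
      {e : I ↪ L | ∀ i, e i ∈ A (c i)}.indicator 1 e := by
    rw [← Set.indicator_pi_one_apply univ (fun i => A (c i)) e]
    simp [Set.indicator]
  have hcard : {e : I ↪ L // ∀ i, e i ∈ A (c i)} ≃ ∀ t, {i // c i = t} ↪ A t :=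
    ((Equiv.embeddingCongr (Equiv.sigmaFiberEquiv c).symm (Equiv.refl L)).subtypeEquiv fun e =>
      ⟨fun he i => i.2.2 ▸ he i.2.1, fun he i => he ⟨c i, i, rfl⟩⟩).trans (sigmaEmbeddingEquiv A hA)
  simp_rw [hind, ← _root_.tsum_subtype, Pi.one_apply]
  rw [ENNReal.tsum_one]
  change ((ENat.card {e : I ↪ L // ∀ i, e i ∈ A (c i)} : ℕ∞) : ℝ≥0∞) = _
  rw [ENat.card_congr hcard, ENat.card_eq_coe_fintype_card, Fintype.card_pi, ENat.toENNReal_coe,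
    Nat.cast_prod]
  simp_rw [Fintype.card_embedding_eq, ← Nat.card_coe_set_eq, Nat.card_eq_fintype_card]

/-! ### Poisson point processes -/

lemma lintegral_poissonMeasure (l : ℝ≥0) (f : ℕ → ℝ≥0∞) :
    ∫⁻ q, f q ∂poissonMeasure l =
      ∑' q : ℕ, f q * ENNReal.ofReal (Real.exp (-l) * l ^ q / q.factorial) := by
  simp_rw [lintegral_countable', poissonMeasure_singleton]

lemma tsum_poissonMeasure_singleton (l : ℝ≥0) : ∑' q : ℕ, poissonMeasure l {q} = 1 := by
  simpa using (lintegral_countable' (μ := poissonMeasure l) 1).symm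

lemma lintegral_poissonMeasure_descFactorial_mul_pow (l g : ℝ≥0) (d : ℕ) :
    ∫⁻ q, (q.descFactorial d : ℝ≥0∞) * (g : ℝ≥0∞) ^ q ∂poissonMeasure l =
      ((l : ℝ≥0∞) * g) ^ d * ENNReal.ofReal (Real.exp (-(l * (1 - g)))) := by
  have hshift (q : ℕ) : ((q + d).descFactorial d : ℝ≥0∞) * (g : ℝ≥0∞) ^ (q + d) *
      ENNReal.ofReal (Real.exp (-l) * l ^ (q + d) / (q + d).factorial) =
        ((l : ℝ≥0∞) * g) ^ d * ENNReal.ofReal (Real.exp (-(l * (1 - g)))) *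
          poissonMeasure (l * g) {q} := by
    have hfact : ((q + d).factorial : ℝ) = q.factorial * (q + d).descFactorial d := by
      exact_mod_cast (Nat.add_sub_cancel q d ▸
        Nat.factorial_mul_descFactorial (Nat.le_add_left d q)).symm
    have hexp : Real.exp (-l) = Real.exp (-(l * (1 - g))) * Real.exp (-(l * g)) := by
      rw [← Real.exp_add]; congr 1; ring
    have hpos : ((q + d).descFactorial d : ℝ) ≠ 0 :=
      right_ne_zero_of_mul (hfact ▸ Nat.cast_ne_zero.2 (Nat.factorial_ne_zero (q + d)))
    rw [← ENNReal.toReal_eq_toReal_iff' (by finiteness) (by finiteness)]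
    simp only [poissonMeasure_singleton, ENNReal.toReal_mul, ENNReal.toReal_pow,
      ENNReal.toReal_natCast, ENNReal.coe_toReal, NNReal.coe_mul]
    rw [ENNReal.toReal_ofReal (by positivity), ENNReal.toReal_ofReal (by positivity),
      ENNReal.toReal_ofReal (by positivity), hfact, hexp]
    field_simp
    ring
  rw [lintegral_poissonMeasure, ← Summable.sum_add_tsum_nat_add' (k := d) ENNReal.summable,
    sum_eq_zero fun q hq => by rw [Nat.descFactorial_of_lt (mem_range.1 hq)]; simp, zero_add]
  simp_rw [hshift]
  rw [ENNReal.tsum_mul_left, tsum_poissonMeasure_singleton, mul_one]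

section PoissonProcess

variable {S E : Type*} [MeasurableSpace S] [MeasurableSpace E] {P : Measure S}
  {x : ℕ → S → E} {ν : Measure E}

lemma measurable_setOf_mem (hx : ∀ k, Measurable (x k)) {A : Set E} (hA : MeasurableSet A) :
    Measurable fun s => {k | x k s ∈ A} :=
  measurable_set_iff.2 fun k => hA.mem.comp (hx k)

lemma IsPoissonProcess.measure_encard_eq (h : IsPoissonProcess P x ν) {T : Type*} [Fintype T]
    (A : T → Set E) (hA : ∀ t, MeasurableSet (A t)) (hν : ∀ t, ν (A t) ≠ ⊤)
    (hd : Pairwise (Function.onFun Disjoint A)) (q : T → ℕ) :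
    P {s | ∀ t, {k | x k s ∈ A t}.encard = (q t : ℕ∞)} =
      ∏ t, poissonMeasure (ν (A t)).toNNReal {q t} := by
  let e := Fintype.equivFin T
  rw [← Equiv.prod_comp e.symm, ← h.counts _ (fun i => A (e.symm i)) (fun _ => hA _)
    (fun _ => hν _) (fun i i' hi => hd (e.symm.injective.ne hi))]
  simp_rw [e.symm.surjective.forall]

lemma IsPoissonProcess.measure_encard_eq_natCast (h : IsPoissonProcess P x ν) {A : Set E}
    (hA : MeasurableSet A) (hν : ν A ≠ ⊤) (q : ℕ) :
    P {s | {k | x k s ∈ A}.encard = q} = poissonMeasure (ν A).toNNReal {q} := by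
  simpa using h.measure_encard_eq (T := Unit) (fun _ => A) (fun _ => hA) (fun _ => hν)
    Subsingleton.pairwise fun _ => q

lemma IsPoissonProcess.ae_finite [IsProbabilityMeasure P] (h : IsPoissonProcess P x ν) {A : Set E}
    (hA : MeasurableSet A) (hν : ν A ≠ ⊤) : ∀ᵐ s ∂P, {k | x k s ∈ A}.Finite := by
  have hm (q : ℕ) : MeasurableSet {s | {k | x k s ∈ A}.encard = q} :=
    (measurable_encard.comp (measurable_setOf_mem h.measurable hA)) (measurableSet_singleton _)
  have hunion : P (⋃ q : ℕ, {s | {k | x k s ∈ A}.encard = q}) = 1 := by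
    rw [measure_iUnion (fun a b hab => Set.disjoint_left.2 fun s hs hs' =>
      hab (Nat.cast_injective (hs.symm.trans hs'))) hm]
    simp_rw [h.measure_encard_eq_natCast hA hν, tsum_poissonMeasure_singleton]
  filter_upwards [(mem_ae_iff_prob_eq_one (MeasurableSet.iUnion hm)).2 hunion] with s hs
  obtain ⟨q, hq⟩ := Set.mem_iUnion.1 hs
  exact Set.finite_of_encard_eq_coe hq

lemma IsPoissonProcess.ae_forall [IsProbabilityMeasure P] (h : IsPoissonProcess P x ν)
    {p : E → Prop} (hp : ∀ᵐ y ∂ν, p y) : ∀ᵐ s ∂P, ∀ k, p (x k s) := by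
  obtain ⟨N, hpN, hN, hνN⟩ := exists_measurable_superset_of_null (ae_iff.1 hp)
  have hempty : P {s | {k | x k s ∈ N}.encard = (0 : ℕ)} = 1 := by
    rw [h.measure_encard_eq_natCast hN (by simp [hνN]), hνN]
    simp [poissonMeasure_singleton]
  have hm : MeasurableSet {s | {k | x k s ∈ N}.encard = (0 : ℕ)} :=
    (measurable_encard.comp (measurable_setOf_mem h.measurable hN)) (measurableSet_singleton _)
  filter_upwards [(mem_ae_iff_prob_eq_one hm).2 hempty] with s hs k
  by_contra hk
  exact Set.eq_empty_iff_forall_notMem.1 (Set.encard_eq_zero.1 hs) k (hpN hk)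

lemma IsPoissonProcess.lintegral_prod_ncard [IsProbabilityMeasure P] (h : IsPoissonProcess P x ν)
    {T : Type*} [Fintype T]
    (A : T → Set E) (hA : ∀ t, MeasurableSet (A t)) (hν : ∀ t, ν (A t) ≠ ⊤)
    (hd : Pairwise (Function.onFun Disjoint A)) (f : T → ℕ → ℝ≥0∞) :
    ∫⁻ s, ∏ t, f t {k | x k s ∈ A t}.ncard ∂P =
      ∏ t, ∫⁻ q, f t q ∂poissonMeasure (ν (A t)).toNNReal := by
  have hm : Measurable fun s => fun t => {k | x k s ∈ A t}.ncard :=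
    measurable_pi_iff.2 fun t => measurable_ncard.comp (measurable_setOf_mem h.measurable (hA t))
  have hlaw : P.map (fun s => fun t => {k | x k s ∈ A t}.ncard) =
      Measure.pi fun t => poissonMeasure (ν (A t)).toNNReal := by
    refine Measure.ext_of_singleton fun q => ?_
    rw [Measure.map_apply hm (measurableSet_singleton _), Measure.pi_singleton,
      ← h.measure_encard_eq A hA hν hd]
    refine measure_congr ?_
    filter_upwards [ae_all_iff.2 fun t => h.ae_finite (hA t) (hν t)] with s hs
    change ((fun t => {k | x k s ∈ A t}.ncard) = q) = ∀ t, {k | x k s ∈ A t}.encard = (q t : ℕ∞)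
    simp_rw [funext_iff, ← (hs _).cast_ncard_eq, Nat.cast_inj]
  rw [← lintegral_map (f := fun q : T → ℕ => ∏ t, f t (q t)) Measurable.of_discrete hm, hlaw,
    lintegral_prod_eq_prod_lintegral_of_indepFun univ _
      (iIndepFun_pi fun t => Measurable.of_discrete.aemeasurable) fun t => Measurable.of_discrete]
  exact prod_congr rfl fun t _ => (measurePreserving_eval _ t).lintegral_comp Measurable.of_discrete

end PoissonProcess

lemma tprod_comp_eq_prod_pow_ncard {L W M : Type*} [CommMonoid M] [TopologicalSpace M]
    {h : W → M} {w : L → W} {R : Finset W} (hR : ∀ k, w k ∉ R → h (w k) = 1)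
    (hfin : ∀ v ∈ R, {k | w k = v}.Finite) :
    ∏' k, h (w k) = ∏ v ∈ R, h v ^ {k | w k = v}.ncard := by
  classical
  have hU : {k | w k ∈ R}.Finite :=
    (R.finite_toSet.biUnion hfin).subset fun k hk => Set.mem_biUnion hk rfl
  rw [tprod_eq_prod (s := hU.toFinset) fun k hk => hR k fun hk' => hk (hU.mem_toFinset.2 hk'),
    ← prod_fiberwise_of_maps_to fun k hk => hU.mem_toFinset.1 hk]
  refine prod_congr rfl fun v hv => ?_
  rw [prod_congr rfl fun k hk => by rw [(mem_filter.1 hk).2], prod_const,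
    ← Set.ncard_coe_finset]
  congr 2
  ext k
  simp +contextual [hv]

section Campbell

variable {S E W : Type*} [MeasurableSpace S] [MeasurableSpace E] {P : Measure S}
  {x : ℕ → S → E} {ν : Measure E} {I : Type*} [Fintype I]

lemma measurable_tsum_embedding {f : I → E → ℝ≥0∞} (hx : ∀ k, Measurable (x k))
    (hf : ∀ i, Measurable (f i)) :
    Measurable fun s => ∑' e : I ↪ ℕ, ∏ i, f i (x (e i) s) := by
  have : Countable (I ↪ ℕ) := Function.Embedding.coe_injective.countable
  exact Measurable.tsum fun e => measurable_fun_prod _ fun i _ => (hf i).comp (hx _)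

lemma IsPoissonProcess.lintegral_tsum_embedding_indicator [IsProbabilityMeasure P]
    (h : IsPoissonProcess P x ν) {T : Type*} [Fintype T]
    (A : T → Set E) (hA : ∀ t, MeasurableSet (A t)) (hν : ∀ t, ν (A t) ≠ ⊤)
    (hd : Pairwise (Function.onFun Disjoint A)) (c : I → T) (g : T → ℝ≥0) :
    ∫⁻ s, (∑' e : I ↪ ℕ, ∏ i, (A (c i)).indicator (1 : E → ℝ≥0∞) (x (e i) s)) *
        ∏ t, (g t : ℝ≥0∞) ^ {k | x k s ∈ A t}.ncard ∂P =
      (∏ i, ν (A (c i)) * g (c i)) *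
        ENNReal.ofReal (Real.exp (-∑ t, (ν (A t)).toReal * (1 - g t))) := by
  classical
  have hcount : ∀ᵐ s ∂P,
      (∑' e : I ↪ ℕ, ∏ i, (A (c i)).indicator (1 : E → ℝ≥0∞) (x (e i) s)) *
        ∏ t, (g t : ℝ≥0∞) ^ {k | x k s ∈ A t}.ncard =
      ∏ t, (({k | x k s ∈ A t}.ncard.descFactorial (Fintype.card {i // c i = t}) : ℝ≥0∞) *
        (g t : ℝ≥0∞) ^ {k | x k s ∈ A t}.ncard) := by
    filter_upwards [ae_all_iff.2 fun t => h.ae_finite (hA t) (hν t)] with s hs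
    rw [prod_mul_distrib, ← tsum_embedding_indicator c (fun t => {k | x k s ∈ A t})
      (fun t t' htt' => (hd htt').preimage fun k => x k s) hs]
    rfl
  have hfiber : ∏ t, (ν (A t) * (g t : ℝ≥0∞)) ^ Fintype.card {i // c i = t} =
      ∏ i, ν (A (c i)) * g (c i) := by
    rw [← prod_fiberwise univ c]
    refine prod_congr rfl fun t _ => ?_
    rw [prod_congr rfl fun i hi => by rw [(mem_filter.1 hi).2], prod_const, Fintype.card_subtype]
  rw [lintegral_congr_ae hcount, h.lintegral_prod_ncard A hA hν hd fun t q =>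
    (q.descFactorial (Fintype.card {i // c i = t}) : ℝ≥0∞) * (g t : ℝ≥0∞) ^ q]
  simp_rw [lintegral_poissonMeasure_descFactorial_mul_pow, ENNReal.coe_toNNReal (hν _)]
  rw [prod_mul_distrib, hfiber, ← sum_neg_distrib, Real.exp_sum,
    ENNReal.ofReal_prod_of_nonneg fun _ _ => (Real.exp_pos _).le]
  rfl

lemma IsPoissonProcess.lintegral_tsum_embedding_sum_indicator [IsProbabilityMeasure P]
    (h : IsPoissonProcess P x ν) {T : Type*} [Fintype T]
    (A : T → Set E) (hA : ∀ t, MeasurableSet (A t)) (hν : ∀ t, ν (A t) ≠ ⊤)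
    (hd : Pairwise (Function.onFun Disjoint A)) (a : I → T → ℝ≥0∞) (g : T → ℝ≥0) :
    ∫⁻ s, (∑' e : I ↪ ℕ, ∏ i, ∑ t, a i t * (A t).indicator 1 (x (e i) s)) *
        ∏ t, (g t : ℝ≥0∞) ^ {k | x k s ∈ A t}.ncard ∂P =
      (∏ i, ∑ t, a i t * (ν (A t) * g t)) *
        ENNReal.ofReal (Real.exp (-∑ t, (ν (A t)).toReal * (1 - g t))) := by
  classical
  have hpow : Measurable fun s => ∏ t, (g t : ℝ≥0∞) ^ {k | x k s ∈ A t}.ncard :=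
    measurable_fun_prod _ fun t _ =>
      (Measurable.of_discrete (f := fun q : ℕ => (g t : ℝ≥0∞) ^ q)).comp
        (measurable_ncard.comp (measurable_setOf_mem h.measurable (hA t)))
  have hm (c : I → T) : Measurable fun s =>
      (∑' e : I ↪ ℕ, ∏ i, (A (c i)).indicator (1 : E → ℝ≥0∞) (x (e i) s)) *
        ∏ t, (g t : ℝ≥0∞) ^ {k | x k s ∈ A t}.ncard :=
    (measurable_tsum_embedding h.measurable fun i =>
      measurable_one.indicator (hA (c i))).mul hpow
  simp_rw [Fintype.prod_sum, Summable.tsum_finsetSum fun _ _ => ENNReal.summable, prod_mul_distrib,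
    ENNReal.tsum_mul_left, sum_mul, mul_assoc]
  rw [lintegral_finsetSum _ fun c _ => (hm c).const_mul _]
  refine sum_congr rfl fun c _ => ?_
  rw [lintegral_const_mul _ (hm c), h.lintegral_tsum_embedding_indicator A hA hν hd,
    prod_mul_distrib]
  ring

/-- The joint simple function of a finite family of simple functions. -/
def simpleFuncPi (f : I → SimpleFunc E W) : SimpleFunc E (I → W) where
  toFun y i := f i y
  measurableSet_fiber' v := by
    have : (fun y i => f i y) ⁻¹' {v} = ⋂ i, f i ⁻¹' {v i} := by ext y; simp [funext_iff]
    exact this ▸ MeasurableSet.iInter fun i => (f i).measurableSet_preimage _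
  finite_range' := (Set.Finite.pi' fun i => (f i).finite_range).subset
    (Set.range_subset_iff.2 fun y _ => Set.mem_range_self y)

lemma finMeasSupp_simpleFuncPi [Zero W] {f : I → SimpleFunc E W} (hf : ∀ i, (f i).FinMeasSupp ν) :
    (simpleFuncPi f).FinMeasSupp ν := by
  simp only [SimpleFunc.finMeasSupp_iff_support] at hf ⊢
  refine (measure_mono fun y (hy : (fun i => f i y) ≠ 0) => ?_).trans_lt
    ((measure_iUnion_fintype_le ν fun i => Function.support (f i)).trans_lt
      (ENNReal.sum_lt_top.2 fun i _ => hf i))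
  exact Set.mem_iUnion.2 (Function.ne_iff.1 hy)

section Level

variable [Zero W] {Φ : SimpleFunc E W} {ψ : W → ℝ≥0∞}

lemma simpleFunc_apply_eq_sum [DecidableEq W] (hψ : ψ 0 = 0) (y : E) :
    ψ (Φ y) = ∑ v : Φ.range.erase 0, ψ v * (Φ ⁻¹' {v.1}).indicator 1 y := by
  rw [sum_coe_sort (Φ.range.erase 0) fun v => ψ v * (Φ ⁻¹' {v}).indicator 1 y,
    sum_erase _ (by simp [hψ]), sum_eq_single_of_mem _ (Φ.mem_range_self y)
      fun v _ hv => by simp [hv.symm]]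
  simp

lemma lintegral_comp_simpleFunc_eq_sum [DecidableEq W] (hψ : ψ 0 = 0) :
    ∫⁻ y, ψ (Φ y) ∂ν = ∑ v : Φ.range.erase 0, ψ v * ν (Φ ⁻¹' {v.1}) := by
  rw [sum_coe_sort (Φ.range.erase 0) fun v => ψ v * ν (Φ ⁻¹' {v}), sum_erase _ (by simp [hψ]),
    ← SimpleFunc.map_lintegral, ← SimpleFunc.lintegral_eq_lintegral]
  rfl

lemma IsPoissonProcess.lintegral_tsum_embedding_comp_simpleFunc [IsProbabilityMeasure P]
    (h : IsPoissonProcess P x ν) (hΦ : Φ.FinMeasSupp ν) {a : I → W → ℝ≥0∞} (ha : ∀ i, a i 0 = 0)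
    {g : W → ℝ≥0∞} (hg0 : g 0 = 1) (hg1 : ∀ v, g v ≤ 1) :
    ∫⁻ s, (∑' e : I ↪ ℕ, ∏ i, a i (Φ (x (e i) s))) * ∏' k, g (Φ (x k s)) ∂P =
      (∏ i, ∫⁻ y, a i (Φ y) * g (Φ y) ∂ν) *
        ENNReal.ofReal (Real.exp (-(∫⁻ y, 1 - g (Φ y) ∂ν).toReal)) := by
  classical
  lift g to W → ℝ≥0 using fun v => ne_top_of_le_ne_top ENNReal.one_ne_top (hg1 v)
  have hν (v : Φ.range.erase 0) : ν (Φ ⁻¹' {v.1}) ≠ ⊤ :=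
    (hΦ.meas_preimage_singleton_ne_zero (ne_of_mem_erase v.2)).ne
  have hd : Pairwise (Function.onFun Disjoint fun v : Φ.range.erase 0 => Φ ⁻¹' {v.1}) :=
    fun v v' hne => (Set.disjoint_singleton.2 fun heq => hne (Subtype.ext heq)).preimage _
  have htprod : ∀ᵐ s ∂P, ∏' k, (g (Φ (x k s)) : ℝ≥0∞) =
      ∏ v : Φ.range.erase 0, (g v : ℝ≥0∞) ^ {k | x k s ∈ Φ ⁻¹' {v.1}}.ncard := by
    filter_upwards [ae_all_iff.2 fun v => h.ae_finite (Φ.measurableSet_preimage _) (hν v)] with s hs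
    rw [tprod_comp_eq_prod_pow_ncard (h := fun v => (g v : ℝ≥0∞)) (w := fun k => Φ (x k s))
      (R := Φ.range.erase 0) (fun k hk => ?_) fun v hv => hs ⟨v, hv⟩, ← prod_coe_sort]
    · rfl
    · have h0 : Φ (x k s) = 0 := not_not.1 fun h0 => hk (mem_erase.2 ⟨h0, Φ.mem_range_self _⟩)
      rwa [h0]
  have hmass : (∫⁻ y, 1 - g (Φ y) ∂ν).toReal =
      ∑ v : Φ.range.erase 0, (ν (Φ ⁻¹' {v.1})).toReal * (1 - g v) := by
    rw [lintegral_comp_simpleFunc_eq_sum (ψ := fun v => 1 - (g v : ℝ≥0∞)) (by simp [hg0]),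
      ENNReal.toReal_sum fun v _ => ENNReal.mul_ne_top (by finiteness) (hν v)]
    refine sum_congr rfl fun v _ => ?_
    rw [ENNReal.toReal_mul, ENNReal.toReal_sub_of_le (hg1 v) ENNReal.one_ne_top,
      ENNReal.toReal_one, ENNReal.coe_toReal, mul_comm]
  have hint (i : I) : ∫⁻ y, a i (Φ y) * g (Φ y) ∂ν =
      ∑ v : Φ.range.erase 0, a i v * (ν (Φ ⁻¹' {v.1}) * g v) := by
    rw [lintegral_comp_simpleFunc_eq_sum (ψ := fun v => a i v * g v) (by simp [ha])]
    exact sum_congr rfl fun v _ => by ring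
  have hval (i : I) (y : E) := simpleFunc_apply_eq_sum (Φ := Φ) (ha i) y
  simp_rw [hint, hval]
  rw [lintegral_congr_ae (htprod.mono fun s hs => congrArg _ hs),
    h.lintegral_tsum_embedding_sum_indicator _ (fun v => Φ.measurableSet_preimage _) hν hd
      (fun i v => a i v) fun v => g v, hmass]

end Level

lemma IsPoissonProcess.lintegral_tsum_embedding_simpleFunc [IsProbabilityMeasure P]
    (h : IsPoissonProcess P x ν) {f : I → SimpleFunc E ℝ≥0∞} {φ : SimpleFunc E ℝ≥0∞}
    (hf : ∀ i, (f i).FinMeasSupp ν) (hφ : φ.FinMeasSupp ν) (hφ1 : ∀ y, φ y ≤ 1) :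
    ∫⁻ s, (∑' e : I ↪ ℕ, ∏ i, f i (x (e i) s)) * ∏' k, (1 - φ (x k s)) ∂P =
      (∏ i, ∫⁻ y, f i y * (1 - φ y) ∂ν) *
        ENNReal.ofReal (Real.exp (-(∫⁻ y, φ y ∂ν).toReal)) := by
  classical
  have joint_formula := h.lintegral_tsum_embedding_comp_simpleFunc
    (a := fun i (v : (I → ℝ≥0∞) × ℝ≥0∞) => v.1 i) (g := fun v => 1 - v.2)
    ((finMeasSupp_simpleFuncPi hf).pair hφ) (fun _ => rfl) (tsub_zero 1) fun _ => tsub_le_self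
  simpa [simpleFuncPi, ENNReal.sub_sub_cancel ENNReal.one_ne_top (hφ1 _)] using joint_formula

lemma finMeasSupp_eapprox {f : E → ℝ≥0∞} (hf : Measurable f) (hfi : ∫⁻ y, f y ∂ν ≠ ⊤) (M : ℕ) :
    (SimpleFunc.eapprox f M).FinMeasSupp ν := by
  refine SimpleFunc.FinMeasSupp.of_lintegral_ne_top ?_
  rw [← SimpleFunc.lintegral_eq_lintegral]
  refine ne_top_of_le_ne_top hfi (lintegral_mono fun y => ?_)
  rw [← SimpleFunc.iSup_eapprox_apply hf y]
  exact le_iSup (fun n => SimpleFunc.eapprox f n y) M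

lemma tendsto_prod_eapprox {f : I → E → ℝ≥0∞} (hf : ∀ i, Measurable (f i))
    (hft : ∀ i y, f i y ≠ ⊤) (y : I → E) :
    Tendsto (fun M => ∏ i, SimpleFunc.eapprox (f i) M (y i)) atTop (𝓝 (∏ i, f i (y i))) :=
  ENNReal.tendsto_finsetProd_of_ne_top _ (fun i _ => SimpleFunc.tendsto_eapprox (hf i) _)
    fun i _ => hft i _

lemma monotone_prod_eapprox (f : I → E → ℝ≥0∞) (y : I → E) :
    Monotone fun M => ∏ i, SimpleFunc.eapprox (f i) M (y i) := fun _ _ hM =>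
  prod_le_prod' fun i _ => SimpleFunc.monotone_eapprox (f i) hM _

theorem IsPoissonProcess.lintegral_tsum_embedding [IsProbabilityMeasure P]
    (h : IsPoissonProcess P x ν) {f : I → E → ℝ≥0∞} (hf : ∀ i, Measurable (f i))
    (hft : ∀ i y, f i y ≠ ⊤) (hfi : ∀ i, ∫⁻ y, f i y ∂ν ≠ ⊤) :
    ∫⁻ s, ∑' e : I ↪ ℕ, ∏ i, f i (x (e i) s) ∂P = ∏ i, ∫⁻ y, f i y ∂ν := by
  have hsimple (M : ℕ) : ∏ i, ∫⁻ y, SimpleFunc.eapprox (f i) M y ∂ν =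
      ∫⁻ s, ∑' e : I ↪ ℕ, ∏ i, SimpleFunc.eapprox (f i) M (x (e i) s) ∂P := by
    simpa using (h.lintegral_tsum_embedding_simpleFunc (φ := 0)
      (fun i => finMeasSupp_eapprox (hf i) (hfi i) M) (by simp [SimpleFunc.FinMeasSupp])
      (by simp)).symm
  refine tendsto_nhds_unique (lintegral_tendsto_of_tendsto_of_monotone (fun M => ?_)
    (ae_of_all _ fun s => ?_) (ae_of_all _ fun s => ?_))
    ((ENNReal.tendsto_finsetProd_of_ne_top univ (fun i _ => ?_) fun i _ => hfi i).congr hsimple)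
  · exact (measurable_tsum_embedding h.measurable
      fun i => (SimpleFunc.eapprox (f i) M).measurable).aemeasurable
  · exact fun M M' hM => ENNReal.tsum_le_tsum fun e => monotone_prod_eapprox f _ hM
  · exact tendsto_tsum_of_monotone (fun e => monotone_prod_eapprox f _)
      fun e => tendsto_prod_eapprox hf hft _
  · exact lintegral_tendsto_of_tendsto_of_monotone
      (fun M => (SimpleFunc.eapprox (f i) M).measurable.aemeasurable)
      (ae_of_all _ fun y M M' hM => SimpleFunc.monotone_eapprox (f i) hM y)
      (ae_of_all _ fun y => SimpleFunc.tendsto_eapprox (hf i) y)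

theorem IsPoissonProcess.lintegral_tsum [IsProbabilityMeasure P]
    (h : IsPoissonProcess P x ν) {f : E → ℝ≥0∞} (hf : Measurable f)
    (hft : ∀ y, f y ≠ ⊤) (hfi : ∫⁻ y, f y ∂ν ≠ ⊤) :
    ∫⁻ s, ∑' k, f (x k s) ∂P = ∫⁻ y, f y ∂ν := by
  have embedding_formula := h.lintegral_tsum_embedding (I := Unit) (fun _ => hf)
    (fun _ => hft) fun _ => hfi
  simp only [univ_unique, prod_singleton] at embedding_formula
  rw [← embedding_formula]
  exact lintegral_congr fun s =>
    (Equiv.tsum_eq Equiv.uniqueEmbeddingEquivResult fun k => f (x k s)).symm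

lemma tendsto_lintegral_tsum_embedding_mul_tprod (hx : ∀ k, Measurable (x k))
    {f : I → E → ℝ≥0∞} (hf : ∀ i, Measurable (f i)) (hft : ∀ i y, f i y ≠ ⊤)
    (hint : ∫⁻ s, ∑' e : I ↪ ℕ, ∏ i, f i (x (e i) s) ∂P ≠ ⊤)
    {φ : E → ℝ≥0∞} (hφ : Measurable φ) :
    Tendsto (fun M => ∫⁻ s, (∑' e : I ↪ ℕ, ∏ i, SimpleFunc.eapprox (f i) M (x (e i) s)) *
        ∏' k, (1 - SimpleFunc.eapprox φ M (x k s)) ∂P) atTop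
      (𝓝 (∫⁻ s, (∑' e : I ↪ ℕ, ∏ i, f i (x (e i) s)) * ∏' k, (1 - φ (x k s)) ∂P)) := by
  have hsum (s : S) : Tendsto
      (fun M => ∑' e : I ↪ ℕ, ∏ i, SimpleFunc.eapprox (f i) M (x (e i) s)) atTop
      (𝓝 (∑' e : I ↪ ℕ, ∏ i, f i (x (e i) s))) :=
    tendsto_tsum_of_monotone (fun e => monotone_prod_eapprox f _)
      fun e => tendsto_prod_eapprox hf hft _
  have hle (M : ℕ) (s : S) : ∑' e : I ↪ ℕ, ∏ i, SimpleFunc.eapprox (f i) M (x (e i) s) ≤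
      ∑' e : I ↪ ℕ, ∏ i, f i (x (e i) s) :=
    ENNReal.tsum_le_tsum fun e => (monotone_prod_eapprox f _).ge_of_tendsto
      (tendsto_prod_eapprox hf hft _) M
  have hprod (s : S) : Tendsto (fun M => ∏' k, (1 - SimpleFunc.eapprox φ M (x k s))) atTop
      (𝓝 (∏' k, (1 - φ (x k s)))) :=
    tendsto_tprod_of_antitone (fun k M M' hM => tsub_le_tsub_left
      (SimpleFunc.monotone_eapprox φ hM _) 1) (fun M k => tsub_le_self) fun k =>
      ENNReal.Tendsto.sub tendsto_const_nhds (SimpleFunc.tendsto_eapprox hφ _)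
        (Or.inl ENNReal.one_ne_top)
  have hprod1 (ψ : E → ℝ≥0∞) (s : S) : ∏' k, (1 - ψ (x k s)) ≤ 1 :=
    tprod_le_one fun k => tsub_le_self
  refine tendsto_lintegral_of_dominated_convergence _ (fun M => ?_)
    (fun M => ae_of_all _ fun s => (mul_le_of_le_one_right' (hprod1 _ s)).trans (hle M s)) hint ?_
  · exact (measurable_tsum_embedding hx fun i => (SimpleFunc.eapprox (f i) M).measurable).mul
      (measurable_tprod (fun k => ((SimpleFunc.eapprox φ M).measurable.comp (hx k)).const_sub 1)
        fun k s => tsub_le_self)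
  · filter_upwards [ae_lt_top (measurable_tsum_embedding hx hf) hint] with s hs
    exact ENNReal.Tendsto.mul (hsum s) (Or.inr (ne_top_of_le_ne_top ENNReal.one_ne_top
      (hprod1 φ s))) (hprod s) (Or.inr hs.ne)

/-- A Campbell–Mecke formula, obtained by approximating `f` and `φ` from below by simple
functions. -/
theorem IsPoissonProcess.lintegral_tsum_embedding_mul_tprod [IsProbabilityMeasure P]
    (h : IsPoissonProcess P x ν) {f : I → E → ℝ≥0∞} (hf : ∀ i, Measurable (f i))
    (hft : ∀ i y, f i y ≠ ⊤) (hfi : ∀ i, ∫⁻ y, f i y ∂ν ≠ ⊤) {φ : E → ℝ≥0∞} (hφ : Measurable φ)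
    (hφ1 : ∀ y, φ y ≤ 1) (hφi : ∫⁻ y, φ y ∂ν ≠ ⊤) :
    ∫⁻ s, (∑' e : I ↪ ℕ, ∏ i, f i (x (e i) s)) * ∏' k, (1 - φ (x k s)) ∂P =
      (∏ i, ∫⁻ y, f i y * (1 - φ y) ∂ν) *
        ENNReal.ofReal (Real.exp (-(∫⁻ y, φ y ∂ν).toReal)) := by
  have hφle (M : ℕ) (y : E) : SimpleFunc.eapprox φ M y ≤ φ y :=
    Monotone.ge_of_tendsto (fun _ _ hM => SimpleFunc.monotone_eapprox φ hM y)
      (SimpleFunc.tendsto_eapprox hφ y) M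
  have hfle (i : I) (M : ℕ) (y : E) : SimpleFunc.eapprox (f i) M y ≤ f i y :=
    Monotone.ge_of_tendsto (fun _ _ hM => SimpleFunc.monotone_eapprox (f i) hM y)
      (SimpleFunc.tendsto_eapprox (hf i) y) M
  have hfφi (i : I) : ∫⁻ y, f i y * (1 - φ y) ∂ν ≠ ⊤ :=
    ne_top_of_le_ne_top (hfi i) (lintegral_mono fun y => mul_le_of_le_one_right' tsub_le_self)
  refine tendsto_nhds_unique ((tendsto_lintegral_tsum_embedding_mul_tprod h.measurable hf hft
    (by rw [h.lintegral_tsum_embedding hf hft hfi]; exact ENNReal.prod_ne_top fun i _ => hfi i)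
    hφ).congr fun M => h.lintegral_tsum_embedding_simpleFunc
      (fun i => finMeasSupp_eapprox (hf i) (hfi i) M) (finMeasSupp_eapprox hφ hφi M)
      fun y => (hφle M y).trans (hφ1 y)) ?_
  refine ENNReal.Tendsto.mul (ENNReal.tendsto_finsetProd_of_ne_top _ (fun i _ => ?_)
      fun i _ => hfφi i) (Or.inr ENNReal.ofReal_ne_top) ?_
    (Or.inr (ENNReal.prod_ne_top fun i _ => hfφi i))
  · refine tendsto_lintegral_of_dominated_convergence (f i) (fun M =>
        (SimpleFunc.eapprox (f i) M).measurable.mul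
          ((SimpleFunc.eapprox φ M).measurable.const_sub 1))
      (fun M => ae_of_all _ fun y => (mul_le_of_le_one_right' tsub_le_self).trans (hfle i M y))
      (hfi i) (ae_of_all _ fun y => ?_)
    exact ENNReal.Tendsto.mul (SimpleFunc.tendsto_eapprox (hf i) y) (Or.inr (by finiteness))
      (ENNReal.Tendsto.sub tendsto_const_nhds (SimpleFunc.tendsto_eapprox hφ y)
        (Or.inl ENNReal.one_ne_top)) (Or.inr (hft i y))
  · exact ENNReal.tendsto_ofReal ((Real.continuous_exp.tendsto _).comp
      ((ENNReal.tendsto_toReal hφi).comp (lintegral_tendsto_of_tendsto_of_monotone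
        (fun M => (SimpleFunc.eapprox φ M).measurable.aemeasurable)
        (ae_of_all _ fun y _ _ hM => SimpleFunc.monotone_eapprox φ hM y)
        (ae_of_all _ fun y => SimpleFunc.tendsto_eapprox hφ y))).neg)

end Campbell

/-! ### Conditionally independent variables -/

section CondIndep

variable {S X' Y' ι : Type*} [MeasurableSpace S] [MeasurableSpace X'] [MeasurableSpace Y']
  {P : Measure S}

lemma lintegral_comp_mul_eq_of_indicator {Y : S → Y'} {κ : S → Measure Y'} (hY : Measurable Y)
    (hκ : Measurable κ) {R R' : S → ℝ≥0∞} (hR : Measurable R) (hR' : Measurable R')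
    (h : ∀ A, MeasurableSet A → ∫⁻ s, A.indicator 1 (Y s) * R s ∂P = ∫⁻ s, κ s A * R' s ∂P)
    {w : Y' → ℝ≥0∞} (hw : Measurable w) :
    ∫⁻ s, w (Y s) * R s ∂P = ∫⁻ s, (∫⁻ y, w y ∂κ s) * R' s ∂P := by
  have lintegral_withDensity : ∀ {R g : S → ℝ≥0∞}, Measurable R → Measurable g →
      ∫⁻ s, g s ∂P.withDensity R = ∫⁻ s, g s * R s ∂P := fun hR hg => by
    simp only [lintegral_withDensity_eq_lintegral_mul _ hR hg, Pi.mul_apply, mul_comm]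
  have map_eq_bind : (P.withDensity R).map Y = (P.withDensity R').bind κ := by
    ext A hA
    have hA1 : Measurable (A.indicator (1 : Y' → ℝ≥0∞)) := measurable_one.indicator hA
    calc (P.withDensity R).map Y A
        = ∫⁻ s, A.indicator 1 (Y s) ∂P.withDensity R := by
          rw [← lintegral_indicator_one hA, lintegral_map hA1 hY]
      _ = ∫⁻ s, κ s A ∂P.withDensity R' := by
          rw [lintegral_withDensity hR (by exact hA1.comp hY),
            lintegral_withDensity hR' (by exact (Measure.measurable_coe hA).comp hκ), h A hA]
      _ = (P.withDensity R').bind κ A := (Measure.bind_apply hA hκ.aemeasurable).symm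
  calc ∫⁻ s, w (Y s) * R s ∂P
      = ∫⁻ y, w y ∂(P.withDensity R).map Y := by
        rw [lintegral_map hw hY, lintegral_withDensity hR (by exact hw.comp hY)]
    _ = ∫⁻ s, (∫⁻ y, w y ∂κ s) * R' s ∂P := by
        rw [map_eq_bind, Measure.lintegral_bind hκ.aemeasurable hw.aemeasurable,
          lintegral_withDensity hR' (by exact (Measure.measurable_lintegral hw).comp hκ)]

variable {X : S → X'} {Y : ι → S → Y'} {κ : ι → X' → Measure Y'}

lemma CondIndepWithLaw.lintegral_prod_indicator (h : CondIndepWithLaw P X Y κ)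
    (hY : ∀ i, Measurable (Y i)) (F : Finset ι) {A : ι → Set Y'} (hA : ∀ i, MeasurableSet (A i)) :
    ∫⁻ s, ∏ i ∈ F, (A i).indicator 1 (Y i s) ∂P = ∫⁻ s, ∏ i ∈ F, κ i (X s) (A i) ∂P := by
  have prod_indicator : ∀ s, ∏ i ∈ F, (A i).indicator (1 : Y' → ℝ≥0∞) (Y i s) =
      (⋂ i ∈ F, Y i ⁻¹' A i).indicator 1 s := fun s => by
    classical
    simp only [Set.indicator_apply, Pi.one_apply, Finset.prod_ite_zero, Finset.prod_const_one,
      Set.mem_iInter, Set.mem_preimage]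
  simp_rw [prod_indicator]
  rw [lintegral_indicator_one (Finset.measurableSet_biInter _ fun i _ => hY i (hA i))]
  simpa [Set.ofPred_forall, Set.preimage] using h F Set.univ A MeasurableSet.univ hA

private lemma CondIndepWithLaw.lintegral_prod_mul_indicator (h : CondIndepWithLaw P X Y κ)
    (hX : Measurable X) (hY : ∀ i, Measurable (Y i)) (hκ : ∀ i, Measurable (κ i))
    {u : ι → Y' → ℝ≥0∞} (hu : ∀ i, Measurable (u i)) (F : Finset ι) :
    ∀ (G : Finset ι) (A : ι → Set Y'), Disjoint F G → (∀ i, MeasurableSet (A i)) →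
      ∫⁻ s, (∏ i ∈ F, u i (Y i s)) * ∏ i ∈ G, (A i).indicator 1 (Y i s) ∂P =
        ∫⁻ s, (∏ i ∈ F, ∫⁻ y, u i y ∂κ i (X s)) * ∏ i ∈ G, κ i (X s) (A i) ∂P := by
  classical
  induction F using Finset.induction_on with
  | empty =>
    intro G A _ hA
    simpa only [Finset.prod_empty, one_mul] using h.lintegral_prod_indicator hY G hA
  | insert i F hi ih =>
    intro G A hFG hA
    obtain ⟨hiG, hFG⟩ := Finset.disjoint_insert_left.1 hFG
    simp only [Finset.prod_insert hi, mul_assoc]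
    refine lintegral_comp_mul_eq_of_indicator (hY i) ((hκ i).comp hX) ?_ ?_ (fun B hB => ?_) (hu i)
    · exact (Finset.measurable_fun_prod _ fun j _ => (hu j).comp (hY j)).mul
        (Finset.measurable_fun_prod _ fun j _ => (measurable_one.indicator (hA j)).comp (hY j))
    · exact (Finset.measurable_fun_prod _ fun j _ =>
        (Measure.measurable_lintegral (hu j)).comp ((hκ j).comp hX)).mul
        (Finset.measurable_fun_prod _ fun j _ =>
          (Measure.measurable_coe (hA j)).comp ((hκ j).comp hX))
    · have update_of_mem : ∀ j ∈ G, Function.update A i B j = A j := fun j hj =>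
        Function.update_of_ne (ne_of_mem_of_not_mem hj hiG) _ _
      have := ih (insert i G) (Function.update A i B) (Finset.disjoint_insert_right.2 ⟨hi, hFG⟩)
        ((Function.forall_update_iff A fun _ => MeasurableSet).2 ⟨hB, fun j _ => hA j⟩)
      simp only [Finset.prod_insert hiG, Function.update_self] at this
      have indicator_update : ∀ s, ∏ j ∈ G, (Function.update A i B j).indicator 1 (Y j s) =
          ∏ j ∈ G, (A j).indicator (1 : Y' → ℝ≥0∞) (Y j s) :=
        fun s => Finset.prod_congr rfl fun j hj => by rw [update_of_mem j hj]
      have law_update : ∀ s, ∏ j ∈ G, κ j (X s) (Function.update A i B j) =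
          ∏ j ∈ G, κ j (X s) (A j) :=
        fun s => Finset.prod_congr rfl fun j hj => by rw [update_of_mem j hj]
      simpa only [indicator_update, law_update, mul_left_comm, Function.comp_apply] using this

lemma CondIndepWithLaw.lintegral_prod (h : CondIndepWithLaw P X Y κ) (hX : Measurable X)
    (hY : ∀ i, Measurable (Y i)) (hκ : ∀ i, Measurable (κ i)) (F : Finset ι)
    {u : ι → Y' → ℝ≥0∞} (hu : ∀ i, Measurable (u i)) :
    ∫⁻ s, ∏ i ∈ F, u i (Y i s) ∂P = ∫⁻ s, ∏ i ∈ F, ∫⁻ y, u i y ∂κ i (X s) ∂P := by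
  classical
  simpa only [Finset.prod_empty, mul_one] using
    h.lintegral_prod_mul_indicator hX hY hκ hu F ∅ (fun _ => ∅) (Finset.disjoint_empty_right F)
      fun _ => MeasurableSet.empty

lemma CondIndepWithLaw.lintegral_tprod {α β : Type*} [Fintype α] [Countable β]
    [IsFiniteMeasure P] {Y : α × β → S → Y'} {κ : α × β → X' → Measure Y'}
    (h : CondIndepWithLaw P X Y κ) (hX : Measurable X) (hY : ∀ i, Measurable (Y i))
    (hκ : ∀ i, Measurable (κ i)) (hκ1 : ∀ᵐ s ∂P, ∀ i, κ i (X s) Set.univ ≤ 1)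
    {u : α × β → Y' → ℝ≥0∞} (hu : ∀ i, Measurable (u i)) (hu1 : ∀ i y, u i y ≤ 1) :
    ∫⁻ s, ∏' b, ∏ a, u (a, b) (Y (a, b) s) ∂P =
      ∫⁻ s, ∏' b, ∏ a, ∫⁻ y, u (a, b) y ∂κ (a, b) (X s) ∂P := by
  have hκu : ∀ᵐ s ∂P, ∀ i, ∫⁻ y, u i y ∂κ i (X s) ≤ 1 := by
    filter_upwards [hκ1] with s hs i
    exact (lintegral_mono (hu1 i)).trans (by simpa only [lintegral_one] using hs i)
  have tendsto_lintegral : ∀ v : α × β → S → ℝ≥0∞, (∀ i, Measurable (v i)) →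
      (∀ᵐ s ∂P, ∀ i, v i s ≤ 1) →
      Tendsto (fun F : Finset β => ∫⁻ s, ∏ i ∈ (univ : Finset α) ×ˢ F, v i s ∂P) atTop
        (𝓝 (∫⁻ s, ∏' b, ∏ a, v (a, b) s ∂P)) := by
    intro v hv hv1
    refine tendsto_lintegral_filter_of_dominated_convergence (fun _ => 1)
      (Eventually.of_forall fun F => Finset.measurable_fun_prod _ fun i _ => hv i)
      (Eventually.of_forall fun F => ?_) (by simp) ?_
    · filter_upwards [hv1] with s hs using Finset.prod_le_one' fun i _ => hs i
    · filter_upwards [hv1] with s hs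
      simp only [Finset.prod_product_right]
      exact (ENNReal.multipliable_of_le_one fun b =>
        Finset.prod_le_one' fun a _ => hs (a, b)).hasProd
  refine tendsto_nhds_unique
    (tendsto_lintegral (fun i s => u i (Y i s)) (fun i => (hu i).comp (hY i))
      (Eventually.of_forall fun s i => hu1 i _)) ?_
  simp only [h.lintegral_prod hX hY hκ _ hu]
  exact tendsto_lintegral (fun i s => ∫⁻ y, u i y ∂κ i (X s))
    (fun i => (Measure.measurable_lintegral (hu i)).comp ((hκ i).comp hX)) hκu

end CondIndep

/-! ### Poisson variables with a gamma distributed mean -/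

lemma measurable_gammaMeasure (a : ℝ) : Measurable fun b : ℝ => gammaMeasure a b := by
  refine Measure.measurable_of_measurable_coe _ fun A hA => ?_
  simp_rw [gammaMeasure, withDensity_apply _ hA]
  refine Measurable.lintegral_prod_right' (f := fun q : ℝ × ℝ => gammaPDF a q.1 q.2) ?_
  refine ENNReal.measurable_ofReal.comp ?_
  exact Measurable.ite (measurableSet_le measurable_const measurable_snd) (by fun_prop)
    measurable_const

lemma ae_gammaMeasure_nonneg (a b : ℝ) : ∀ᵐ t ∂gammaMeasure a b, 0 ≤ t := by
  simp only [ae_iff, not_le, gammaMeasure]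
  rw [Set.Iio_def, withDensity_apply _ measurableSet_Iio, lintegral_gammaPDF_of_nonpos le_rfl]

lemma gammaPDFReal_mul_pow_mul_exp {a b q t : ℝ} (ha : 0 < a) (hbq : 0 < b + q) (ht : 0 < t)
    (n : ℕ) :
    gammaPDFReal a b t * (t ^ n * Real.exp (-(q * t))) =
      Real.Gamma (n + a) / Real.Gamma a * (b ^ a / (b + q) ^ (a + n)) *
        gammaPDFReal (a + n) (b + q) t := by
  have rpow_ne_zero : (b + q) ^ (a + n) ≠ 0 := (Real.rpow_pos_of_pos hbq _).ne'
  have Gamma_ne_zero : Real.Gamma (a + n) ≠ 0 := (Real.Gamma_pos_of_pos (by positivity)).ne'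
  rw [gammaPDFReal, gammaPDFReal, if_pos ht.le, if_pos ht.le, add_comm (n : ℝ) a,
    add_sub_right_comm, Real.rpow_add ht, Real.rpow_natCast, add_mul, neg_add, Real.exp_add]
  field_simp

lemma lintegral_gammaMeasure_pow_mul_exp {a b q : ℝ} (ha : 0 < a) (hb : 0 < b) (hbq : 0 < b + q)
    (n : ℕ) :
    ∫⁻ t, ENNReal.ofReal (t ^ n * Real.exp (-(q * t))) ∂gammaMeasure a b =
      ENNReal.ofReal (Real.Gamma (n + a) / Real.Gamma a * (b ^ a / (b + q) ^ (a + n))) := by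
  have ratio_nonneg :
      0 ≤ Real.Gamma (n + a) / Real.Gamma a * (b ^ a / (b + q) ^ (a + n)) := by
    have := Real.Gamma_pos_of_pos ha
    have := Real.Gamma_pos_of_pos (show 0 < n + a by positivity)
    positivity
  have density_ae : ∀ᵐ t : ℝ,
      (gammaPDF a b * fun t => ENNReal.ofReal (t ^ n * Real.exp (-(q * t)))) t =
        ENNReal.ofReal (Real.Gamma (n + a) / Real.Gamma a * (b ^ a / (b + q) ^ (a + n))) *
          gammaPDF (a + n) (b + q) t := by
    filter_upwards [show ∀ᵐ t : ℝ, t ≠ 0 by simp [ae_iff]] with t ht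
    rw [Pi.mul_apply]
    rcases lt_or_gt_of_ne ht with ht | ht
    · rw [gammaPDF_of_neg ht, gammaPDF_of_neg ht, zero_mul, mul_zero]
    · rw [gammaPDF, gammaPDF, ← ENNReal.ofReal_mul (gammaPDFReal_nonneg ha hb t),
        ← ENNReal.ofReal_mul ratio_nonneg, gammaPDFReal_mul_pow_mul_exp ha hbq ht]
  have measurable_gammaPDF : ∀ a b, Measurable (gammaPDF a b) := fun a b =>
    (measurable_gammaPDFReal a b).ennreal_ofReal
  rw [gammaMeasure, lintegral_withDensity_eq_lintegral_mul _ (measurable_gammaPDF a b)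
      (by fun_prop), lintegral_congr_ae density_ae,
    lintegral_const_mul _ (measurable_gammaPDF _ _),
    lintegral_gammaPDF_eq_one (by positivity) hbq, mul_one]

lemma lintegral_gammaMeasure_pow_mul_exp_neg {a p : ℝ} (ha : 0 < a) (hp : p ∈ Set.Ioo (0 : ℝ) 1)
    (n : ℕ) :
    ∫⁻ t, ENNReal.ofReal (t ^ n * Real.exp (-t)) ∂gammaMeasure a ((1 - p) / p) =
      ENNReal.ofReal (Real.Gamma (n + a) / Real.Gamma a * (p ^ n * (1 - p) ^ a)) := by
  obtain ⟨hp0, hp1⟩ := hp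
  have hp1 : 0 < 1 - p := sub_pos.2 hp1
  have rate_add_one : (1 - p) / p + 1 = p⁻¹ := by field_simp; ring
  have integral_eq := lintegral_gammaMeasure_pow_mul_exp (q := 1) ha (div_pos hp1 hp0)
    (by positivity) n
  have rpow_ne_zero : p ^ a ≠ 0 := (Real.rpow_pos_of_pos hp0 _).ne'
  simp only [one_mul, rate_add_one] at integral_eq
  rw [integral_eq, Real.div_rpow hp1.le hp0.le, Real.inv_rpow hp0.le, Real.rpow_add hp0,
    Real.rpow_natCast]
  congr 2
  field_simp

lemma poissonMeasure_toNNReal_singleton {t : ℝ} (ht : 0 ≤ t) (q : ℕ) :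
    poissonMeasure t.toNNReal {q} = ENNReal.ofReal (Real.exp (-t) * t ^ q / q.factorial) := by
  rw [poissonMeasure_singleton, Real.coe_toNNReal t ht]

lemma measurable_poissonMeasure_toNNReal_singleton (q : ℕ) :
    Measurable fun t : ℝ => poissonMeasure t.toNNReal {q} := by
  simp only [poissonMeasure_singleton]
  fun_prop

lemma lintegral_poissonMeasure_gammaMeasure {a p : ℝ} (ha : 0 < a) (hp : p ∈ Set.Ioo (0 : ℝ) 1)
    (q : ℕ) :
    ∫⁻ t, poissonMeasure t.toNNReal {q} ∂gammaMeasure a ((1 - p) / p) =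
      ENNReal.ofReal
        (Real.Gamma (q + a) / (q.factorial * Real.Gamma a) * (p ^ q * (1 - p) ^ a)) := by
  have poisson_ae : ∀ᵐ t ∂gammaMeasure a ((1 - p) / p), poissonMeasure t.toNNReal {q} =
      ENNReal.ofReal (q.factorial : ℝ)⁻¹ * ENNReal.ofReal (t ^ q * Real.exp (-t)) := by
    filter_upwards [ae_gammaMeasure_nonneg a _] with t ht
    rw [poissonMeasure_toNNReal_singleton ht, ← ENNReal.ofReal_mul (by positivity)]
    ring_nf
  rw [lintegral_congr_ae poisson_ae, lintegral_const_mul _ (by fun_prop),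
    lintegral_gammaMeasure_pow_mul_exp_neg ha hp, ← ENNReal.ofReal_mul (by positivity)]
  congr 1
  field_simp

lemma lintegral_one_sub_exp_neg_gammaMeasure {a p : ℝ} (ha : 0 < a)
    (hp : p ∈ Set.Ioo (0 : ℝ) 1) :
    ∫⁻ t, ENNReal.ofReal (1 - Real.exp (-t)) ∂gammaMeasure a ((1 - p) / p) =
      ENNReal.ofReal (1 - (1 - p) ^ a) := by
  have := isProbabilityMeasure_gammaMeasure ha (div_pos (sub_pos.2 hp.2) hp.1)
  have integral_exp : ∫⁻ t, ENNReal.ofReal (Real.exp (-t)) ∂gammaMeasure a ((1 - p) / p) =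
      ENNReal.ofReal ((1 - p) ^ a) := by
    simpa [(Real.Gamma_pos_of_pos ha).ne'] using lintegral_gammaMeasure_pow_mul_exp_neg ha hp 0
  simp only [ENNReal.ofReal_sub _ (Real.exp_nonneg _), ENNReal.ofReal_one]
  rw [lintegral_sub (by fun_prop) (by rw [integral_exp]; exact ENNReal.ofReal_ne_top) ?_,
    integral_exp, lintegral_one, measure_univ,
    ENNReal.ofReal_sub _ (Real.rpow_nonneg (sub_pos.2 hp.2).le _), ENNReal.ofReal_one]
  filter_upwards [ae_gammaMeasure_nonneg a _] with t ht
  exact ENNReal.ofReal_le_one.2 (Real.exp_le_one_iff.2 (neg_nonpos.2 ht))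

/-! ### Beta integrals and the digamma function -/

lemma differentiableAt_Gamma_of_pos {x : ℝ} (hx : 0 < x) : DifferentiableAt ℝ Real.Gamma x :=
  Real.differentiableAt_Gamma fun m => ((neg_nonpos.2 m.cast_nonneg).trans_lt hx).ne'

lemma monotoneOn_digamma : MonotoneOn digamma (Set.Ioi 0) := by
  have differentiableAt_log_Gamma : ∀ x ∈ Set.Ioi (0 : ℝ),
      DifferentiableAt ℝ (Real.log ∘ Real.Gamma) x := fun x hx =>
    (differentiableAt_Gamma_of_pos hx).log (Real.Gamma_pos_of_pos hx).ne'
  refine (Real.convexOn_log_Gamma.monotoneOn_deriv differentiableAt_log_Gamma).congr fun x hx => ?_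
  exact Real.deriv_log_comp_eq_logDeriv (differentiableAt_Gamma_of_pos hx)
    (Real.Gamma_pos_of_pos hx).ne'

lemma hasDerivAt_Gamma_div_Gamma_add {x : ℝ} (hx : 0 < x) :
    HasDerivAt (fun ε => Real.Gamma x / Real.Gamma (ε + x)) (-digamma x) 0 := by
  have Gamma_ne_zero := (Real.Gamma_pos_of_pos hx).ne'
  have hasDerivAt_Gamma_add :
      HasDerivAt (fun ε => Real.Gamma (ε + x)) (deriv Real.Gamma x) 0 := by
    have := (differentiableAt_Gamma_of_pos hx).hasDerivAt
    rw [← zero_add x] at this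
    simpa only [zero_add] using this.comp_add_const 0 x
  refine ((hasDerivAt_const (0 : ℝ) (Real.Gamma x)).div hasDerivAt_Gamma_add
    (by simpa only [zero_add] using Gamma_ne_zero)).congr_deriv ?_
  simp only [zero_add, zero_mul, zero_sub, digamma, logDeriv_apply]
  field_simp

lemma tendsto_beta_sub_beta {c d : ℝ} (hc : 0 < c) (hd : 0 < d) :
    Tendsto (fun ε => beta ε c - beta ε d) (𝓝[>] 0) (𝓝 (digamma d - digamma c)) := by
  have tendsto_slope := ((hasDerivAt_Gamma_div_Gamma_add hc).sub
    (hasDerivAt_Gamma_div_Gamma_add hd)).tendsto_slope_zero_right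
  have tendsto_Gamma : Tendsto (fun ε : ℝ => Real.Gamma (ε + 1)) (𝓝[>] 0) (𝓝 1) := by
    have : ContinuousAt (fun ε : ℝ => Real.Gamma (ε + 1)) 0 :=
      ContinuousAt.comp (g := Real.Gamma)
        (by simpa using (differentiableAt_Gamma_of_pos one_pos).continuousAt) (by fun_prop)
    simpa only [zero_add, Real.Gamma_one] using this.tendsto.mono_left nhdsWithin_le_nhds
  have tendsto_mul := tendsto_Gamma.mul tendsto_slope
  rw [one_mul, neg_sub_neg] at tendsto_mul
  refine tendsto_mul.congr' ?_
  filter_upwards [self_mem_nhdsWithin] with ε (hε : 0 < ε)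
  simp only [Pi.sub_apply, zero_add, smul_eq_mul, beta, Real.Gamma_add_one hε.ne',
    div_self (Real.Gamma_pos_of_pos hc).ne', div_self (Real.Gamma_pos_of_pos hd).ne']
  field_simp
  ring

lemma lintegral_Ioo_beta {α β : ℝ} (hα : 0 < α) (hβ : 0 < β) :
    ∫⁻ p in Set.Ioo (0 : ℝ) 1, ENNReal.ofReal (p ^ (α - 1) * (1 - p) ^ (β - 1)) =
      ENNReal.ofReal (beta α β) := by
  have lintegral_betaPDF := lintegral_betaPDF_eq_one hα hβ
  simp_rw [ProbabilityTheory.lintegral_betaPDF, mul_assoc,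
    ENNReal.ofReal_mul (one_div_pos.2 (beta_pos hα hβ)).le] at lintegral_betaPDF
  rw [lintegral_const_mul _ (by fun_prop), one_div, ENNReal.ofReal_inv_of_pos (beta_pos hα hβ)]
    at lintegral_betaPDF
  simpa only [inv_inv] using ENNReal.eq_inv_of_mul_eq_one_left
    ((mul_comm _ _).trans lintegral_betaPDF)

lemma lintegral_Ioo_rpow_mul_one_sub_rpow {ε c r : ℝ} (hε : 0 < ε) (hc : 0 < c) (hr : 0 ≤ r) :
    ∫⁻ p in Set.Ioo (0 : ℝ) 1, ENNReal.ofReal (p ^ (ε - 1)) *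
        ENNReal.ofReal ((1 - p) ^ (c - 1) * (1 - (1 - p) ^ r)) =
      ENNReal.ofReal (beta ε c - beta ε (c + r)) := by
  have hcr : 0 < c + r := by linarith
  rw [ENNReal.ofReal_sub _ (beta_pos hε hcr).le, ← lintegral_Ioo_beta hε hc,
    ← lintegral_Ioo_beta hε hcr, ← lintegral_sub (by fun_prop)
      (by rw [lintegral_Ioo_beta hε hcr]; exact ENNReal.ofReal_ne_top)]
  · refine setLIntegral_congr_fun measurableSet_Ioo fun p ⟨hp0, hp1⟩ => ?_
    have hp1 : 0 < 1 - p := sub_pos.2 hp1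
    rw [← ENNReal.ofReal_sub _ (by positivity), ← ENNReal.ofReal_mul (by positivity),
      add_sub_right_comm, Real.rpow_add hp1]
    ring_nf
  · refine (ae_restrict_iff' measurableSet_Ioo).2 (ae_of_all _ fun p ⟨hp0, hp1⟩ => ?_)
    have hp1 : 0 < 1 - p := sub_pos.2 hp1
    refine ENNReal.ofReal_le_ofReal (mul_le_mul_of_nonneg_left ?_ (by positivity))
    exact Real.rpow_le_rpow_of_exponent_ge hp1 (by linarith) (by linarith)

lemma tendsto_lintegral_Ioo_rpow_mul {f : ℝ → ℝ≥0∞} (hf : Measurable f) :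
    Tendsto (fun n : ℕ => ∫⁻ p in Set.Ioo (0 : ℝ) 1,
        ENNReal.ofReal (p ^ (1 / ((n : ℝ) + 1) - 1)) * f p) atTop
      (𝓝 (∫⁻ p in Set.Ioo (0 : ℝ) 1, ENNReal.ofReal p⁻¹ * f p)) := by
  refine lintegral_tendsto_of_tendsto_of_monotone (fun n => by fun_prop) ?_ ?_
  · refine (ae_restrict_iff' measurableSet_Ioo).2 (ae_of_all _ fun p ⟨hp0, hp1⟩ n n' hn => ?_)
    refine mul_le_mul_left (ENNReal.ofReal_le_ofReal ?_) _
    exact Real.rpow_le_rpow_of_exponent_ge hp0 hp1.le (by gcongr)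
  · refine (ae_restrict_iff' measurableSet_Ioo).2 (ae_of_all _ fun p ⟨hp0, _⟩ => ?_)
    refine ENNReal.Tendsto.mul_const (ENNReal.tendsto_ofReal ?_)
      (Or.inl (ENNReal.ofReal_pos.2 (inv_pos.2 hp0)).ne')
    rw [← Real.rpow_neg_one p, ← zero_sub]
    exact (Real.continuousAt_const_rpow hp0.ne').tendsto.comp
      (tendsto_one_div_add_atTop_nhds_zero_nat.sub_const 1)

lemma lintegral_Ioo_inv_mul_one_sub_rpow {c r : ℝ} (hc : 0 < c) (hr : 0 ≤ r) :
    ∫⁻ p in Set.Ioo (0 : ℝ) 1,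
        ENNReal.ofReal p⁻¹ * ENNReal.ofReal ((1 - p) ^ (c - 1) * (1 - (1 - p) ^ r)) =
      ENNReal.ofReal (digamma (c + r) - digamma c) := by
  have tendsto_exponent : Tendsto (fun n : ℕ => 1 / ((n : ℝ) + 1)) atTop (𝓝[>] 0) :=
    tendsto_nhdsWithin_iff.2 ⟨tendsto_one_div_add_atTop_nhds_zero_nat,
      Eventually.of_forall fun n => Set.mem_Ioi.2 Nat.one_div_pos_of_nat⟩
  refine tendsto_nhds_unique (tendsto_lintegral_Ioo_rpow_mul (by fun_prop)) ?_
  simp only [lintegral_Ioo_rpow_mul_one_sub_rpow Nat.one_div_pos_of_nat hc hr]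
  exact ENNReal.tendsto_ofReal
    ((tendsto_beta_sub_beta hc (by linarith)).comp tendsto_exponent)

/-! ### Integrals with respect to the Lévy measure -/

section Levy

variable {Ω : Type*} [MeasurableSpace Ω] {B₀ : Measure Ω} {c : ℝ}

lemma ae_betaLevy_mem_Ioo : ∀ᵐ y ∂betaLevy c B₀, y.1 ∈ Set.Ioo (0 : ℝ) 1 := by
  have ae_mem_Ioo : ∀ᵐ p ∂(volume.restrict (Set.Ioo (0 : ℝ) 1)).withDensity
      (fun p => ENNReal.ofReal (p⁻¹ * (1 - p) ^ (c - 1))), p ∈ Set.Ioo (0 : ℝ) 1 :=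
    withDensity_absolutelyContinuous _ _ (ae_restrict_mem measurableSet_Ioo)
  exact Measure.quasiMeasurePreserving_fst.ae ae_mem_Ioo

variable [SFinite B₀]

lemma lintegral_betaLevy {f : ℝ → ℝ≥0∞} (hf : Measurable f) :
    ∫⁻ y, f y.1 ∂betaLevy c B₀ = B₀ Set.univ *
      ∫⁻ p in Set.Ioo (0 : ℝ) 1, ENNReal.ofReal (p⁻¹ * (1 - p) ^ (c - 1)) * f p := by
  rw [betaLevy, MeasureTheory.lintegral_prod (fun y : ℝ × Ω => f y.1)
    (hf.comp measurable_fst).aemeasurable]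
  simp only [lintegral_const]
  rw [lintegral_mul_const _ hf, lintegral_withDensity_eq_lintegral_mul _ (by fun_prop) hf,
    mul_comm]
  simp only [Pi.mul_apply]

lemma lintegral_betaLevy_pow_mul_rpow {r : ℝ} (hcr : 0 < c + r) {n : ℕ} (hn : 1 ≤ n) :
    ∫⁻ y, ENNReal.ofReal (y.1 ^ n * (1 - y.1) ^ r) ∂betaLevy c B₀ =
      B₀ Set.univ * ENNReal.ofReal (beta n (c + r)) := by
  rw [lintegral_betaLevy (f := fun p => ENNReal.ofReal (p ^ n * (1 - p) ^ r)) (by fun_prop),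
    ← lintegral_Ioo_beta (by exact_mod_cast hn) hcr]
  congr 1
  refine setLIntegral_congr_fun measurableSet_Ioo fun p ⟨hp0, hp1⟩ => ?_
  have hp1 : 0 < 1 - p := sub_pos.2 hp1
  rw [← ENNReal.ofReal_mul (by positivity), add_sub_right_comm, Real.rpow_add hp1,
    Real.rpow_sub_one hp0.ne', Real.rpow_natCast]
  ring_nf

lemma lintegral_betaLevy_one_sub_rpow (hc : 0 < c) {r : ℝ} (hr : 0 ≤ r) :
    ∫⁻ y, ENNReal.ofReal (1 - (1 - y.1) ^ r) ∂betaLevy c B₀ =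
      B₀ Set.univ * ENNReal.ofReal (digamma (c + r) - digamma c) := by
  rw [lintegral_betaLevy (f := fun p => ENNReal.ofReal (1 - (1 - p) ^ r)) (by fun_prop),
    ← lintegral_Ioo_inv_mul_one_sub_rpow hc hr]
  congr 1
  refine setLIntegral_congr_fun measurableSet_Ioo fun p ⟨hp0, hp1⟩ => ?_
  have : 0 < 1 - p := sub_pos.2 hp1
  rw [ENNReal.ofReal_mul (inv_pos.2 hp0).le, mul_assoc, ← ENNReal.ofReal_mul (by positivity)]

end Levy

/-! ### Partitions and labellings -/

section Labels

variable {D L : Type*} [Fintype D] [DecidableEq D]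

open Classical in
/-- The partition of a finite type into the level sets of a labelling; `clusters` is the case of
data points labelled by natural numbers. -/
def kerPartition (l : D → L) : Finpartition (univ : Finset D) :=
  Finpartition.ofSetoid (Setoid.ker l)

lemma mem_part_kerPartition {l : D → L} {a b : D} :
    b ∈ (kerPartition l).part a ↔ l a = l b := by
  classical
  rw [kerPartition, Finpartition.mem_part_ofSetoid_iff_rel]
  rfl

lemma eq_of_part_eq {π π' : Finpartition (univ : Finset D)} (h : ∀ a, π.part a = π'.part a) :
    π = π' := by
  have parts_subset : ∀ {ρ ρ' : Finpartition (univ : Finset D)}, (∀ a, ρ.part a = ρ'.part a) →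
      ρ.parts ⊆ ρ'.parts := by
    intro ρ ρ' hρ A hA
    obtain ⟨a, ha⟩ := ρ.nonempty_of_mem_parts hA
    rw [← ρ.part_eq_of_mem hA ha, hρ]
    exact ρ'.part_mem.2 (mem_univ a)
  exact Finpartition.ext ((parts_subset h).antisymm (parts_subset fun a => (h a).symm))

lemma kerPartition_eq_iff {l : D → L} {π : Finpartition (univ : Finset D)} :
    kerPartition l = π ↔ ∀ a b, b ∈ π.part a ↔ l a = l b := by
  constructor
  · rintro rfl a b
    exact mem_part_kerPartition
  · intro h
    refine eq_of_part_eq fun a => ?_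
    ext b
    rw [mem_part_kerPartition, h]

/-- The labelling giving the points of the block `A` the label `e A`. -/
def labelOf (π : Finpartition (univ : Finset D)) (e : π.parts ↪ L) (a : D) : L :=
  e ⟨π.part a, π.part_mem.2 (mem_univ a)⟩

lemma labelOf_eq_iff {π : Finpartition (univ : Finset D)} {e : π.parts ↪ L} {a : D}
    {A : π.parts} : labelOf π e a = e A ↔ a ∈ A.1 := by
  rw [labelOf, e.injective.eq_iff, Subtype.ext_iff]
  exact π.part_eq_iff_mem A.2

lemma kerPartition_labelOf (π : Finpartition (univ : Finset D)) (e : π.parts ↪ L) :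
    kerPartition (labelOf π e) = π :=
  kerPartition_eq_iff.2 fun a b => by
    rw [eq_comm, ← labelOf_eq_iff (e := e) (A := ⟨π.part a, π.part_mem.2 (mem_univ a)⟩)]
    rfl

/-- The labellings with the blocks of `π` as level sets are the injections from the blocks to the
labels. -/
def labelEquiv (π : Finpartition (univ : Finset D)) (L : Type*) :
    (π.parts ↪ L) ≃ {l : D → L // kerPartition l = π} :=
  Equiv.ofBijective (fun e => ⟨labelOf π e, kerPartition_labelOf π e⟩) <| by
    choose q hq using fun A : π.parts => π.nonempty_of_mem_parts A.2
    have part_q : ∀ A : π.parts, π.part (q A) = A.1 := fun A => π.part_eq_of_mem A.2 (hq A)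
    constructor
    · intro e e' h
      ext A
      rw [← labelOf_eq_iff.2 (hq A), ← labelOf_eq_iff.2 (hq A)]
      exact congrFun (congrArg Subtype.val h) (q A)
    · rintro ⟨l, hl⟩
      rw [kerPartition_eq_iff] at hl
      refine ⟨⟨fun A => l (q A), fun A A' h => Subtype.ext ?_⟩, Subtype.ext (funext fun a => ?_)⟩
      · have hmem := (hl (q A) (q A')).2 h
        rw [part_q] at hmem
        rw [← part_q A', π.part_eq_of_mem A.2 hmem]
      · exact (hl _ a).1 (by rw [part_q]; exact π.mem_part (mem_univ a))

lemma image_labelOf [DecidableEq L] (π : Finpartition (univ : Finset D)) (e : π.parts ↪ L) :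
    univ.image (labelOf π e) = univ.map e := by
  ext k
  simp only [mem_image, Finset.mem_map, mem_univ, true_and]
  constructor
  · rintro ⟨a, rfl⟩
    exact ⟨_, rfl⟩
  · rintro ⟨A, rfl⟩
    obtain ⟨a, ha⟩ := π.nonempty_of_mem_parts A.2
    exact ⟨a, labelOf_eq_iff.2 ha⟩

lemma surjective_iff_card_parts_kerPartition [Fintype L] {l : D → L} :
    Function.Surjective l ↔ #(kerPartition l).parts = Fintype.card L := by
  classical
  obtain ⟨e, he⟩ := (labelEquiv (kerPartition l) L).surjective ⟨l, rfl⟩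
  have image_l : univ.image l = univ.map e := by
    rw [← image_labelOf]
    exact congrArg (fun l' => univ.image l'.1) he.symm
  rw [← Fintype.card_coe, ← card_univ, ← card_map e, ← image_l, card_eq_iff_eq_univ,
    eq_univ_iff_forall]
  simp only [Function.Surjective, mem_image, mem_univ, true_and]

lemma sum_filter_kerPartition_eq {M : Type*} [AddCommMonoid M] [Fintype L]
    (π : Finpartition (univ : Finset D)) (F : (D → L) → M) :
    ∑ l with kerPartition l = π, F l = ∑ e : π.parts ↪ L, F (labelOf π e) := by
  rw [sum_subtype (p := fun l => kerPartition l = π) _ (by simp), ← (labelEquiv π L).sum_comp]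
  rfl

end Labels

/-! ### Counting labellings with given level set sizes -/

section Multinomial

variable {L : Type*} [Fintype L]

lemma prod_X_pow_eq_monomial (u : L → ℕ) :
    ∏ k, (MvPolynomial.X k : MvPolynomial L ℕ) ^ u k =
      MvPolynomial.monomial (Finsupp.equivFunOnFinite.symm u) 1 := by
  rw [MvPolynomial.monomial_eq, Finsupp.prod_fintype _ _ (by simp), map_one, one_mul]
  rfl

variable {N : ℕ}

lemma coeff_sum_X_pow_eq_card [DecidableEq L] (u : L → ℕ) :
    MvPolynomial.coeff (Finsupp.equivFunOnFinite.symm u)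
        ((∑ k, MvPolynomial.X k : MvPolynomial L ℕ) ^ N) =
      #{t : Fin N → L | (fun k => #{i | t i = k}) = u} := by
  have prod_X (t : Fin N → L) : ∏ i, (MvPolynomial.X (t i) : MvPolynomial L ℕ) =
      MvPolynomial.monomial (Finsupp.equivFunOnFinite.symm fun k => #{i | t i = k}) 1 := by
    simp only [← prod_X_pow_eq_monomial, ← prod_fiberwise' univ t, prod_const]
  simp only [Fintype.sum_pow, prod_X, MvPolynomial.coeff_sum, MvPolynomial.coeff_monomial,
    EmbeddingLike.apply_eq_iff_eq, sum_boole, Nat.cast_id]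

lemma coeff_sum_X_pow_eq_multinomial {u : L → ℕ} (hu : ∑ k, u k = N) :
    MvPolynomial.coeff (Finsupp.equivFunOnFinite.symm u)
        ((∑ k, MvPolynomial.X k : MvPolynomial L ℕ) ^ N) = Nat.multinomial univ u := by
  classical
  simp only [sum_pow_eq_sum_piAntidiag, prod_X_pow_eq_monomial, MvPolynomial.coeff_sum,
    ← map_natCast (MvPolynomial.C (σ := L) (R := ℕ)), MvPolynomial.coeff_C_mul,
    MvPolynomial.coeff_monomial, EmbeddingLike.apply_eq_iff_eq, mul_ite, mul_one, mul_zero,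
    sum_ite_eq', Nat.cast_id]
  exact if_pos (by simp [hu])

lemma card_fiber_card_eq_mul_prod_factorial [DecidableEq L] {u : L → ℕ}
    (hu : ∑ k, u k = N) :
    #{t : Fin N → L | (fun k => #{i | t i = k}) = u} * ∏ k, (u k).factorial = N.factorial := by
  rw [← coeff_sum_X_pow_eq_card, coeff_sum_X_pow_eq_multinomial hu, mul_comm, ← hu,
    Nat.multinomial_spec]

end Multinomial

section FiberSizes

variable {J : ℕ} {n : Fin J → ℕ} {L : Type*} [DecidableEq L]

/-- The count vectors of the level sets of a labelling of the data points. -/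
def fiberSizes (l : DataPoint n → L) (k : L) : Fin J → ℕ :=
  clusterSize {a | l a = k}

lemma fiberSizes_apply (l : DataPoint n → L) (k : L) (j : Fin J) :
    fiberSizes l k j = #{i | l ⟨j, i⟩ = k} := by
  rw [fiberSizes, clusterSize, filter_filter]
  symm
  refine card_bij (fun i _ => ⟨j, i⟩) (by simp) (by simp) ?_
  rintro ⟨j', i⟩ h
  obtain ⟨hl, rfl⟩ := (mem_filter.1 h).2
  exact ⟨i, by simpa using hl, rfl⟩

lemma fiberSizes_labelOf (π : Finpartition (univ : Finset (DataPoint n))) (e : π.parts ↪ L)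
    (A : π.parts) : fiberSizes (labelOf π e) (e A) = clusterSize A.1 := by
  rw [fiberSizes]
  congr 1
  ext a
  simp [labelOf_eq_iff]

lemma fiberSizes_eq_zero_of_notMem_image {l : DataPoint n → L} {k : L} (hk : k ∉ univ.image l) :
    fiberSizes l k = 0 := by
  have fiber_eq_empty : ({a | l a = k} : Finset (DataPoint n)) = ∅ :=
    filter_eq_empty_iff.2 fun a ha h => hk (mem_image.2 ⟨a, ha, h⟩)
  rw [fiberSizes, fiber_eq_empty]
  rfl

lemma prod_image_labelOf {M : Type*} [CommMonoid M]
    (π : Finpartition (univ : Finset (DataPoint n))) (e : π.parts ↪ L)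
    (H : L → (Fin J → ℕ) → M) :
    ∏ k ∈ univ.image (labelOf π e), H k (fiberSizes (labelOf π e) k) =
      ∏ A, H (e A) (clusterSize A.1) := by
  simp only [image_labelOf, prod_map, fiberSizes_labelOf]

lemma prod_dataPoint_eq_prod_image {M : Type*} [CommMonoid M] (l : DataPoint n → L)
    (w : Fin J → L → M) :
    ∏ a, w a.1 (l a) = ∏ k ∈ univ.image l, ∏ j, w j k ^ fiberSizes l k j := by
  rw [← prod_fiberwise_of_maps_to (fun a ha => mem_image_of_mem l ha)]
  refine prod_congr rfl fun k _ => ?_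
  rw [prod_congr rfl (g := fun a => w a.1 k) fun a ha => by rw [(mem_filter.1 ha).2],
    ← prod_fiberwise' _ Sigma.fst fun j => w j k]
  simp only [prod_const, fiberSizes, clusterSize]

lemma sum_fiberSizes [Fintype L] (l : DataPoint n → L) : ∑ k, fiberSizes l k = n := by
  funext j
  simp only [Finset.sum_apply, fiberSizes_apply]
  rw [← card_eq_sum_card_fiberwise fun _ _ => mem_univ _, card_univ, Fintype.card_fin]

lemma sum_clusterSize (A : Finset (DataPoint n)) : ∑ j, clusterSize A j = #A :=
  (card_eq_sum_card_fiberwise fun _ _ => mem_univ _).symm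

lemma one_le_sum_clusterSize {π : Finpartition (univ : Finset (DataPoint n))}
    {A : Finset (DataPoint n)} (hA : A ∈ π.parts) : 1 ≤ ∑ j, clusterSize A j := by
  rw [sum_clusterSize, one_le_card]
  exact π.nonempty_of_mem_parts hA

end FiberSizes

/-! ### The two sums in the partition probability function -/

section Decompositions

variable {J : ℕ} {n : Fin J → ℕ} {K : ℕ}

lemma mem_decompositions {v : Fin K → Fin J → ℕ} :
    v ∈ decompositions n K ↔ ∑ k, v k = n ∧ ∀ k, 1 ≤ ∑ j, v k j := by
  rw [decompositions, mem_filter, and_iff_right_iff_imp]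
  rintro ⟨rfl, -⟩
  exact Fintype.mem_piFinset.2 fun k =>
    mem_Iic.2 (single_le_sum (f := v) (fun _ _ => zero_le) (mem_univ k))

lemma fiberSizes_mem_decompositions {l : DataPoint n → Fin K} :
    fiberSizes l ∈ decompositions n K ↔ Function.Surjective l := by
  rw [mem_decompositions, and_iff_right (sum_fiberSizes l)]
  refine forall_congr' fun k => ?_
  rw [fiberSizes, sum_clusterSize, one_le_card]
  simp [Finset.Nonempty]

lemma card_fiberSizes_eq_mul_prod_factorial {v : Fin K → Fin J → ℕ} (hv : ∑ k, v k = n) :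
    #{l : DataPoint n → Fin K | fiberSizes l = v} * ∏ k, ∏ j, (v k j).factorial =
      ∏ j, (n j).factorial := by
  have sum_v : ∀ j, ∑ k, v k j = n j := fun j => by rw [← hv, Finset.sum_apply]
  have card_eq : #{l : DataPoint n → Fin K | fiberSizes l = v} =
      ∏ j, #{t : Fin (n j) → Fin K | (fun k => #{i | t i = k}) = fun k => v k j} := by
    rw [← Fintype.card_piFinset]
    refine card_equiv (Equiv.piCurry fun _ _ => Fin K) fun l => ?_
    simp only [mem_filter, mem_univ, true_and, Fintype.mem_piFinset, funext_iff,
      fiberSizes_apply]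
    exact forall_comm
  rw [Finset.prod_comm, card_eq, ← prod_mul_distrib]
  exact prod_congr rfl fun j _ => card_fiber_card_eq_mul_prod_factorial (sum_v j)

lemma sum_surjective_eq_sum_finpartition (W : (Fin J → ℕ) → ℝ) (K : ℕ) :
    ∑ l : DataPoint n → Fin K with Function.Surjective l, ∏ k, W (fiberSizes l k) =
      K.factorial * ∑ π : Finpartition (univ : Finset (DataPoint n)) with #π.parts = K,
        ∏ A ∈ π.parts, W (clusterSize A) := by
  have mem_iff (l : DataPoint n → Fin K) : Function.Surjective l ↔
      kerPartition l ∈ ({π | #π.parts = K} : Finset (Finpartition univ)) := by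
    rw [surjective_iff_card_parts_kerPartition, Fintype.card_fin, mem_filter_univ]
  have prod_labelOf (π : Finpartition (univ : Finset (DataPoint n))) (hπ : #π.parts = K)
      (e : π.parts ↪ Fin K) :
      ∏ k, W (fiberSizes (labelOf π e) k) = ∏ A ∈ π.parts, W (clusterSize A) := by
    have he : Function.Bijective e :=
      (Fintype.bijective_iff_injective_and_card e).2 ⟨e.injective, by simp [hπ]⟩
    simp only [← he.prod_comp, fiberSizes_labelOf]
    exact prod_coe_sort π.parts fun A => W (clusterSize A)
  simp only [mem_iff]
  rw [← sum_fiberwise_eq_sum_filter, mul_sum]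
  refine sum_congr rfl fun π hπ => ?_
  have card_parts : #π.parts = K := (mem_filter.1 hπ).2
  simp only [sum_filter_kerPartition_eq, prod_labelOf π card_parts, sum_const, card_univ,
    Fintype.card_embedding_eq, Fintype.card_fin, Fintype.card_coe, card_parts,
    Nat.descFactorial_self, nsmul_eq_mul]

lemma sum_surjective_eq_sum_decompositions (W : (Fin J → ℕ) → ℝ) (K : ℕ) :
    ∑ l : DataPoint n → Fin K with Function.Surjective l, ∏ k, W (fiberSizes l k) =
      (∏ j, ((n j).factorial : ℝ)) *
        ∑ v ∈ decompositions n K, ∏ k, (W (v k) / ∏ j, ((v k j).factorial : ℝ)) := by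
  simp only [← fiberSizes_mem_decompositions]
  rw [← sum_fiberwise_eq_sum_filter, mul_sum]
  refine sum_congr rfl fun v hv => ?_
  have card_eq : (#{l : DataPoint n → Fin K | fiberSizes l = v} : ℝ) *
      ∏ k, ∏ j, ((v k j).factorial : ℝ) = ∏ j, ((n j).factorial : ℝ) := by
    exact_mod_cast card_fiberSizes_eq_mul_prod_factorial (mem_decompositions.1 hv).1
  rw [sum_congr rfl (g := fun _ => ∏ k, W (v k))
    (fun l hl => by rw [(mem_filter.1 hl).2]), sum_const, nsmul_eq_mul, prod_div_distrib, ← card_eq]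
  have : ∏ k, ∏ j, ((v k j).factorial : ℝ) ≠ 0 := by positivity
  field_simp

/-- The product over the groups of the rising factorials `r j * (r j + 1) * ⋯ * (r j + v j - 1)`:
the part of a cluster's weight that comes from integrating out the gamma weights. -/
def groupWeight (r : Fin J → ℝ) (v : Fin J → ℕ) : ℝ :=
  ∏ j, Real.Gamma (v j + r j) / Real.Gamma (r j)

lemma groupWeight_pos {r : Fin J → ℝ} (hr : ∀ j, 0 < r j) (v : Fin J → ℕ) : 0 < groupWeight r v :=
  prod_pos fun j _ => div_pos
    (Real.Gamma_pos_of_pos (add_pos_of_nonneg_of_pos (Nat.cast_nonneg _) (hr j)))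
    (Real.Gamma_pos_of_pos (hr j))

/-- The factor contributed to the numerator of the partition probability function by a cluster
with count vector `v`. -/
def clusterWeight (r : Fin J → ℝ) (c : ℝ) (v : Fin J → ℕ) : ℝ :=
  columnTotalWeight r c v * groupWeight r v

lemma eppfNumerator_eq_prod_clusterWeight (r : Fin J → ℝ) (c γ₀ : ℝ)
    (π : Finpartition (univ : Finset (DataPoint n))) :
    eppfNumerator r c γ₀ n π = γ₀ ^ #π.parts / (∏ j, ((n j).factorial : ℝ)) *
      ∏ A ∈ π.parts, clusterWeight r c (clusterSize A) :=
  rfl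

lemma eppfDenominator_eq_sum_clusterWeight (r : Fin J → ℝ) (c γ₀ : ℝ) (n : Fin J → ℕ) :
    eppfDenominator r c γ₀ n = ∑ K ∈ Icc 1 (∑ j, n j), γ₀ ^ K / (K.factorial : ℝ) *
      ∑ v ∈ decompositions n K,
        ∏ k, (clusterWeight r c (v k) / ∏ j, ((v k j).factorial : ℝ)) := by
  refine sum_congr rfl fun K _ => congrArg _ (sum_congr rfl fun v _ => prod_congr rfl fun k _ => ?_)
  rw [clusterWeight, groupWeight, mul_div_assoc, ← prod_div_distrib]
  simp only [div_div, mul_comm]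

lemma card_parts_mem_Icc (hn : 1 ≤ ∑ j, n j) (π : Finpartition (univ : Finset (DataPoint n))) :
    #π.parts ∈ Icc 1 (∑ j, n j) := by
  have card_dataPoint : #(univ : Finset (DataPoint n)) = ∑ j, n j := by
    simp [card_univ, Fintype.card_sigma]
  obtain ⟨a, ha⟩ : (univ : Finset (DataPoint n)).Nonempty := by
    rwa [← one_le_card, card_dataPoint]
  rw [mem_Icc, one_le_card, ← card_dataPoint]
  exact ⟨⟨_, π.part_mem.2 ha⟩, π.card_parts_le_card⟩

theorem sum_eppfNumerator (r : Fin J → ℝ) (c γ₀ : ℝ) (hn : 1 ≤ ∑ j, n j) :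
    ∑ π : Finpartition (univ : Finset (DataPoint n)), eppfNumerator r c γ₀ n π =
      eppfDenominator r c γ₀ n := by
  rw [eppfDenominator_eq_sum_clusterWeight,
    ← sum_fiberwise_of_maps_to (fun π _ => card_parts_mem_Icc hn π)]
  refine sum_congr rfl fun K _ => ?_
  have numerator_eq (π : Finpartition (univ : Finset (DataPoint n)))
      (hπ : π ∈ ({π | #π.parts = K} : Finset (Finpartition univ))) :
      eppfNumerator r c γ₀ n π = γ₀ ^ K / (∏ j, ((n j).factorial : ℝ)) *
        ∏ A ∈ π.parts, clusterWeight r c (clusterSize A) := by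
    rw [eppfNumerator_eq_prod_clusterWeight, (mem_filter.1 hπ).2]
  have double_count :=
    (sum_surjective_eq_sum_finpartition (n := n) (clusterWeight r c) K).symm.trans
      (sum_surjective_eq_sum_decompositions (clusterWeight r c) K)
  rw [sum_congr rfl numerator_eq, ← mul_sum, div_mul_eq_mul_div, div_mul_eq_mul_div,
    div_eq_div_iff (by positivity) (by positivity)]
  linear_combination γ₀ ^ K * double_count

lemma columnTotalWeight_pos {r : Fin J → ℝ} {c : ℝ} (hc : 0 < c) (hr : ∀ j, 0 < r j)
    {v : Fin J → ℕ} (hv : 1 ≤ ∑ j, v j) : 0 < columnTotalWeight r c v := by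
  have sum_v_pos : (0 : ℝ) < ∑ j, (v j : ℝ) := by exact_mod_cast hv
  have sum_r_nonneg : 0 ≤ ∑ j, r j := sum_nonneg fun j _ => (hr j).le
  exact div_pos (mul_pos (Real.Gamma_pos_of_pos sum_v_pos) (Real.Gamma_pos_of_pos (by linarith)))
    (Real.Gamma_pos_of_pos (by linarith))

lemma eppfNumerator_nonneg {r : Fin J → ℝ} {c γ₀ : ℝ} (hc : 0 < c) (hr : ∀ j, 0 < r j)
    (hγ : 0 ≤ γ₀) (π : Finpartition (univ : Finset (DataPoint n))) :
    0 ≤ eppfNumerator r c γ₀ n π :=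
  mul_nonneg (by positivity) (prod_nonneg fun _ hA => mul_nonneg
    (columnTotalWeight_pos hc hr (one_le_sum_clusterSize hA)).le (groupWeight_pos hr _).le)

lemma eppfNumerator_pos {r : Fin J → ℝ} {c γ₀ : ℝ} (hc : 0 < c) (hr : ∀ j, 0 < r j)
    (hγ : 0 < γ₀) (π : Finpartition (univ : Finset (DataPoint n))) :
    0 < eppfNumerator r c γ₀ n π :=
  mul_pos (by positivity) (prod_pos fun _ hA => mul_pos
    (columnTotalWeight_pos hc hr (one_le_sum_clusterSize hA)) (groupWeight_pos hr _))

lemma eppfDenominator_pos {r : Fin J → ℝ} {c γ₀ : ℝ} (hc : 0 < c) (hr : ∀ j, 0 < r j)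
    (hγ : 0 < γ₀) (hn : 1 ≤ ∑ j, n j) : 0 < eppfDenominator r c γ₀ n := by
  rw [← sum_eppfNumerator r c γ₀ hn]
  exact sum_pos (fun π _ => eppfNumerator_pos hc hr hγ π) univ_nonempty

lemma eppfNumerator_congr (r : Fin J → ℝ) (c γ₀ : ℝ)
    {π π' : Finpartition (univ : Finset (DataPoint n))}
    (h : π.parts.val.map clusterSize = π'.parts.val.map clusterSize) :
    eppfNumerator r c γ₀ n π = eppfNumerator r c γ₀ n π' := by
  have prod_eq (ρ : Finpartition (univ : Finset (DataPoint n))) :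
      ∏ A ∈ ρ.parts, clusterWeight r c (clusterSize A) =
        ((ρ.parts.val.map clusterSize).map (clusterWeight r c)).prod := by
    rw [Multiset.map_map]
    rfl
  have card_eq : #π.parts = #π'.parts := by simpa using congrArg Multiset.card h
  simp only [eppfNumerator_eq_prod_clusterWeight, card_eq, prod_eq, h]

end Decompositions

/-! ### The weights of the model -/

section Model

variable {S Ω : Type*} [MeasurableSpace S] [MeasurableSpace Ω] {J : ℕ} {P : Measure S}
  {r : Fin J → ℝ} {c : ℝ} {B₀ : Measure Ω} {atom : ℕ → S → ℝ × Ω} {θ : Fin J → ℕ → S → ℝ}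
  {m : Fin J → S → ℕ} {z : Fin J → ℕ → S → ℕ}

lemma IsModel.measurable_atoms (h : IsModel P r c B₀ atom θ m z) :
    Measurable fun s k => atom k s :=
  measurable_pi_iff.2 h.beta_process.measurable

lemma measurable_gammaMeasure_atom (a : ℝ) (k : ℕ) :
    Measurable fun x : ℕ → ℝ × Ω => gammaMeasure a ((1 - (x k).1) / (x k).1) :=
  (measurable_gammaMeasure a).comp (f := fun x : ℕ → ℝ × Ω => (1 - (x k).1) / (x k).1) (by fun_prop)

lemma IsModel.lintegral_weight (h : IsModel P r c B₀ atom θ m z) {u : ℝ → ℝ≥0∞}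
    (hu : Measurable u) (j : Fin J) (k : ℕ) :
    ∫⁻ s, u (θ j k s) ∂P =
      ∫⁻ s, ∫⁻ t, u t ∂gammaMeasure (r j) ((1 - (atom k s).1) / (atom k s).1) ∂P := by
  simpa only [prod_singleton] using h.gamma_process.lintegral_prod h.measurable_atoms
    (fun jk => h.measurable_weight jk.1 jk.2) (fun jk => measurable_gammaMeasure_atom (r jk.1) jk.2)
    {(j, k)} (u := fun _ => u) fun _ => hu

lemma IsModel.ae_weight_nonneg (h : IsModel P r c B₀ atom θ m z) :
    ∀ᵐ s ∂P, ∀ j k, 0 ≤ θ j k s := by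
  refine ae_all_iff.2 fun j => ae_all_iff.2 fun k => ?_
  have negPart_eq_zero : ∀ b, ∫⁻ t, ENNReal.ofReal (-t) ∂gammaMeasure (r j) b = 0 := fun b =>
    lintegral_eq_zero_of_ae_eq_zero <| by
      filter_upwards [ae_gammaMeasure_nonneg (r j) b] with t ht
        using ENNReal.ofReal_of_nonpos (neg_nonpos.2 ht)
  have lintegral_negPart : ∫⁻ s, ENNReal.ofReal (-θ j k s) ∂P = 0 := by
    rw [h.lintegral_weight (u := fun t => ENNReal.ofReal (-t)) (by fun_prop) j k]
    simp only [negPart_eq_zero, lintegral_zero]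
  rw [lintegral_eq_zero_iff (by exact (h.measurable_weight j k).neg.ennreal_ofReal)]
    at lintegral_negPart
  filter_upwards [lintegral_negPart] with s hs
  exact neg_nonpos.1 (ENNReal.ofReal_eq_zero.1 hs)

lemma summable_of_summable_one_sub_exp_neg {f : ℕ → ℝ}
    (hf : Summable fun k => 1 - Real.exp (-f k)) : Summable f := by
  simpa using (Real.summable_log_one_add_of_summable hf.neg).neg

variable [IsProbabilityMeasure P]

lemma IsModel.ae_mem_Ioo (h : IsModel P r c B₀ atom θ m z) :
    ∀ᵐ s ∂P, ∀ k, (atom k s).1 ∈ Set.Ioo (0 : ℝ) 1 :=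
  h.beta_process.ae_forall ae_betaLevy_mem_Ioo

variable [IsFiniteMeasure B₀]

lemma IsModel.lintegral_tsum_one_sub_exp_neg (h : IsModel P r c B₀ atom θ m z) (hc : 0 < c)
    {j : Fin J} (hr : 0 < r j) :
    ∫⁻ s, ∑' k, ENNReal.ofReal (1 - Real.exp (-θ j k s)) ∂P =
      B₀ Set.univ * ENNReal.ofReal (digamma (c + r j) - digamma c) := by
  have hu : Measurable fun t => ENNReal.ofReal (1 - Real.exp (-t)) := by fun_prop
  have hv : Measurable fun y : ℝ × Ω => ENNReal.ofReal (1 - (1 - y.1) ^ r j) := by fun_prop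
  have levy_integral := lintegral_betaLevy_one_sub_rpow (B₀ := B₀) hc hr.le
  calc ∫⁻ s, ∑' k, ENNReal.ofReal (1 - Real.exp (-θ j k s)) ∂P
      = ∑' k, ∫⁻ s, ENNReal.ofReal (1 - (1 - (atom k s).1) ^ r j) ∂P := by
        rw [lintegral_tsum fun k => by exact (hu.comp (h.measurable_weight j k)).aemeasurable]
        refine tsum_congr fun k => (h.lintegral_weight hu j k).trans (lintegral_congr_ae ?_)
        filter_upwards [h.ae_mem_Ioo] with s hs
          using lintegral_one_sub_exp_neg_gammaMeasure hr (hs k)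
    _ = ∫⁻ s, ∑' k, ENNReal.ofReal (1 - (1 - (atom k s).1) ^ r j) ∂P :=
        (lintegral_tsum fun k => by exact (hv.comp (h.beta_process.measurable k)).aemeasurable).symm
    _ = ∫⁻ y, ENNReal.ofReal (1 - (1 - y.1) ^ r j) ∂betaLevy c B₀ :=
        h.beta_process.lintegral_tsum hv (fun _ => ENNReal.ofReal_ne_top)
          (by rw [levy_integral]; finiteness)
    _ = B₀ Set.univ * ENNReal.ofReal (digamma (c + r j) - digamma c) := levy_integral

lemma IsModel.ae_summable (h : IsModel P r c B₀ atom θ m z) (hc : 0 < c) (hr : ∀ j, 0 < r j) :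
    ∀ᵐ s ∂P, ∀ j, Summable fun k => θ j k s := by
  refine ae_all_iff.2 fun j => ?_
  have hmeas : Measurable fun s => ∑' k, ENNReal.ofReal (1 - Real.exp (-θ j k s)) :=
    Measurable.tsum fun k => by have := h.measurable_weight j k; fun_prop
  have ae_finite := ae_lt_top hmeas (by rw [h.lintegral_tsum_one_sub_exp_neg hc (hr j)]; finiteness)
  filter_upwards [ae_finite, h.ae_weight_nonneg] with s hfin hnonneg
  refine summable_of_summable_one_sub_exp_neg
    ((ENNReal.summable_toReal hfin.ne).congr fun k => ENNReal.toReal_ofReal ?_)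
  exact sub_nonneg.2 (Real.exp_le_one_iff.2 (neg_nonpos.2 (hnonneg j k)))

end Model

/-! ### The probability of a labelling -/

lemma tprod_ofReal_exp_neg {t : ℕ → ℝ} (hs : Summable t) :
    ∏' k, ENNReal.ofReal (Real.exp (-t k)) = ENNReal.ofReal (Real.exp (-∑' k, t k)) := by
  refine HasProd.tprod_eq ?_
  have := (ENNReal.continuous_ofReal.tendsto _).comp hs.hasSum.neg.rexp
  refine this.congr fun s => ENNReal.ofReal_prod_of_nonneg fun k _ => (Real.exp_pos _).le

lemma categorical_singleton (t : ℕ → ℝ) (k : ℕ) :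
    categorical t {k} = ENNReal.ofReal (t k / ∑' l, t l) := by
  rw [categorical, Measure.sum_smul_dirac_singleton]

lemma poissonMeasure_mul_prod_categorical {t : ℕ → ℝ} (ht : ∀ k, 0 ≤ t k) (hs : Summable t) {N : ℕ}
    (l : Fin N → ℕ) :
    poissonMeasure (∑' k, t k).toNNReal {N} * ∏ i, categorical t {l i} =
      ENNReal.ofReal (1 / N.factorial) *
        ((∏ i, ENNReal.ofReal (t (l i))) * ENNReal.ofReal (Real.exp (-∑' k, t k))) := by
  have total_nonneg : 0 ≤ ∑' k, t k := tsum_nonneg ht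
  have pow_mul_prod_div : (∑' k, t k) ^ N * ∏ i, t (l i) / ∑' k, t k = ∏ i, t (l i) := by
    rw [prod_div_distrib, prod_const, card_univ, Fintype.card_fin]
    refine mul_div_cancel_of_imp' fun hT => ?_
    have hN : N ≠ 0 := by rintro rfl; simp at hT
    have total_eq_zero : ∑' k, t k = 0 := eq_zero_of_pow_eq_zero hT
    refine prod_eq_zero (mem_univ ⟨0, Nat.pos_of_ne_zero hN⟩) (le_antisymm ?_ (ht _))
    exact (hs.le_tsum _ fun k _ => ht k).trans_eq total_eq_zero
  rw [poissonMeasure_toNNReal_singleton total_nonneg]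
  simp only [categorical_singleton]
  rw [← ENNReal.ofReal_prod_of_nonneg fun i _ => ht _,
    ← ENNReal.ofReal_prod_of_nonneg fun i _ => div_nonneg (ht _) total_nonneg,
    ← ENNReal.ofReal_mul (by positivity), ← ENNReal.ofReal_mul (prod_nonneg fun i _ => ht _),
    ← ENNReal.ofReal_mul (by positivity)]
  congr 1
  linear_combination (Real.exp (-∑' k, t k) / N.factorial) * pow_mul_prod_div

section PoissonSplitting

variable {J : ℕ} {n : Fin J → ℕ}

lemma prod_ofReal_exp_neg_tsum {t : Fin J → ℕ → ℝ} (hs : ∀ j, Summable (t j)) :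
    ∏ j, ENNReal.ofReal (Real.exp (-∑' k, t j k)) =
      ∏' k, ENNReal.ofReal (Real.exp (-∑ j, t j k)) := by
  rw [tprod_ofReal_exp_neg (summable_sum fun j _ => hs j),
    Summable.tsum_finsetSum fun j _ => hs j, ← sum_neg_distrib, Real.exp_sum,
    ENNReal.ofReal_prod_of_nonneg fun j _ => (Real.exp_pos _).le]

lemma prod_poissonMeasure_singleton {t : Fin J → ℝ} (ht : ∀ j, 0 ≤ t j) (q : Fin J → ℕ) :
    ∏ j, poissonMeasure (t j).toNNReal {q j} =
      (∏ j, ENNReal.ofReal (t j ^ q j / (q j).factorial)) *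
        ENNReal.ofReal (Real.exp (-∑ j, t j)) := by
  rw [← sum_neg_distrib, Real.exp_sum,
    ENNReal.ofReal_prod_of_nonneg fun j _ => (Real.exp_pos _).le, ← prod_mul_distrib]
  refine prod_congr rfl fun j _ => ?_
  have := ht j
  rw [poissonMeasure_toNNReal_singleton (ht j), ← ENNReal.ofReal_mul (by positivity)]
  ring_nf

lemma prod_factorial_mul_tprod_poissonMeasure {t : Fin J → ℕ → ℝ} (ht : ∀ j k, 0 ≤ t j k)
    (l : DataPoint n → ℕ) :
    (∏ k ∈ univ.image l, ∏ j, ((fiberSizes l k j).factorial : ℝ≥0∞)) *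
        ∏' k, ∏ j, poissonMeasure (t j k).toNNReal {fiberSizes l k j} =
      (∏ a, ENNReal.ofReal (t a.1 (l a))) * ∏' k, ENNReal.ofReal (Real.exp (-∑ j, t j k)) := by
  have factorial_mul (k : ℕ) (j : Fin J) (q : ℕ) : (q.factorial : ℝ≥0∞) *
      ENNReal.ofReal (t j k ^ q / q.factorial) = ENNReal.ofReal (t j k) ^ q := by
    rw [← ENNReal.ofReal_natCast, ← ENNReal.ofReal_mul (by positivity),
      mul_div_cancel₀ _ (by positivity), ENNReal.ofReal_pow (ht j k)]
  simp only [prod_poissonMeasure_singleton fun j => ht j _]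
  rw [tprod_mul_of_eq_one_off_finset (univ.image l), ← mul_assoc, ← prod_mul_distrib,
    prod_dataPoint_eq_prod_image l fun j k => ENNReal.ofReal (t j k)]
  · simp only [← prod_mul_distrib, factorial_mul]
  · intro k hk
    simp [fiberSizes_eq_zero_of_notMem_image hk]
  · exact fun k _ => ENNReal.prod_ne_top fun j _ => ENNReal.ofReal_ne_top
  · intro k
    rw [ENNReal.ofReal_le_one, Real.exp_le_one_iff, neg_nonpos]
    exact sum_nonneg fun j _ => ht j k

-- A Poisson number of points with independent labels has independent Poisson label counts.
lemma prod_poissonMeasure_mul_prod_categorical {t : Fin J → ℕ → ℝ} (ht : ∀ j k, 0 ≤ t j k)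
    (hs : ∀ j, Summable (t j)) (l : DataPoint n → ℕ) :
    (∏ j, poissonMeasure (∑' k, t j k).toNNReal {n j}) * ∏ a, categorical (t a.1) {l a} =
      (∏ j, ENNReal.ofReal (1 / (n j).factorial)) *
        ((∏ k ∈ univ.image l, ∏ j, ((fiberSizes l k j).factorial : ℝ≥0∞)) *
          ∏' k, ∏ j, poissonMeasure (t j k).toNNReal {fiberSizes l k j}) := by
  rw [prod_factorial_mul_tprod_poissonMeasure ht, ← prod_ofReal_exp_neg_tsum hs,
    Fintype.prod_sigma, Fintype.prod_sigma]
  simp only [← prod_mul_distrib]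
  exact prod_congr rfl fun j _ =>
    poissonMeasure_mul_prod_categorical (ht j) (hs j) fun i => l ⟨j, i⟩

end PoissonSplitting

section NegativeBinomial

variable {J : ℕ} {n : Fin J → ℕ} {r : Fin J → ℝ}

lemma prod_lintegral_poissonMeasure_gammaMeasure (hr : ∀ j, 0 < r j) {p : ℝ}
    (hp : p ∈ Set.Ioo (0 : ℝ) 1) (q : Fin J → ℕ) :
    ∏ j, ∫⁻ t, poissonMeasure t.toNNReal {q j} ∂gammaMeasure (r j) ((1 - p) / p) =
      ENNReal.ofReal (groupWeight r q * p ^ (∑ j, q j) / ∏ j, ((q j).factorial : ℝ)) *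
        ENNReal.ofReal ((1 - p) ^ ∑ j, r j) := by
  have hp0 : 0 ≤ p := hp.1.le
  have one_sub_pos : 0 < 1 - p := sub_pos.2 hp.2
  have weight_nonneg : 0 ≤ groupWeight r q := (groupWeight_pos hr q).le
  have factor_nonneg (j : Fin J) :
      0 ≤ Real.Gamma (q j + r j) / ((q j).factorial * Real.Gamma (r j)) *
        (p ^ q j * (1 - p) ^ r j) := by
    have := hr j
    positivity
  simp only [lintegral_poissonMeasure_gammaMeasure (hr _) hp]
  rw [← ENNReal.ofReal_prod_of_nonneg fun j _ => factor_nonneg j,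
    ← ENNReal.ofReal_mul (by positivity)]
  congr 1
  rw [groupWeight, Real.rpow_sum_of_pos one_sub_pos, ← prod_pow_eq_pow_sum]
  simp only [prod_mul_distrib, prod_div_distrib]
  ring

lemma ofReal_one_sub_rpow_le_one {p ρ : ℝ} (hp : p ∈ Set.Ioo (0 : ℝ) 1) (hρ : 0 ≤ ρ) :
    ENNReal.ofReal ((1 - p) ^ ρ) ≤ 1 :=
  ENNReal.ofReal_le_one.2
    (Real.rpow_le_one (sub_nonneg.2 hp.2.le) (sub_le_self _ hp.1.le) hρ)

lemma prod_factorial_mul_tprod_lintegral_gammaMeasure (hr : ∀ j, 0 < r j) {p : ℕ → ℝ}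
    (hp : ∀ k, p k ∈ Set.Ioo (0 : ℝ) 1) (l : DataPoint n → ℕ) :
    (∏ k ∈ univ.image l, ∏ j, ((fiberSizes l k j).factorial : ℝ≥0∞)) *
        ∏' k, ∏ j, ∫⁻ t, poissonMeasure t.toNNReal {fiberSizes l k j}
          ∂gammaMeasure (r j) ((1 - p k) / p k) =
      (∏ k ∈ univ.image l, ENNReal.ofReal
          (groupWeight r (fiberSizes l k) * p k ^ (∑ j, fiberSizes l k j))) *
        ∏' k, ENNReal.ofReal ((1 - p k) ^ ∑ j, r j) := by
  have factorial_mul (x : ℝ) (q : Fin J → ℕ) : (∏ j, ((q j).factorial : ℝ≥0∞)) *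
      ENNReal.ofReal (x / ∏ j, ((q j).factorial : ℝ)) = ENNReal.ofReal x := by
    simp only [← ENNReal.ofReal_natCast]
    rw [← ENNReal.ofReal_prod_of_nonneg fun j _ => Nat.cast_nonneg _,
      ← ENNReal.ofReal_mul (by positivity), mul_div_cancel₀ _ (by positivity)]
  have Gamma_ne_zero (j : Fin J) : Real.Gamma (r j) ≠ 0 := (Real.Gamma_pos_of_pos (hr j)).ne'
  simp only [prod_lintegral_poissonMeasure_gammaMeasure hr (hp _)]
  rw [tprod_mul_of_eq_one_off_finset (univ.image l), ← mul_assoc, ← prod_mul_distrib]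
  · simp only [factorial_mul]
  · intro k hk
    simp [fiberSizes_eq_zero_of_notMem_image hk, groupWeight, Gamma_ne_zero]
  · exact fun k _ => ENNReal.ofReal_ne_top
  · exact fun k => ofReal_one_sub_rpow_le_one (hp k) (sum_nonneg fun j _ => (hr j).le)

end NegativeBinomial

section Labelling

variable {S Ω : Type*} [MeasurableSpace S] [MeasurableSpace Ω] {J : ℕ} {P : Measure S}
  {r : Fin J → ℝ} {c : ℝ} {B₀ : Measure Ω} {atom : ℕ → S → ℝ × Ω} {θ : Fin J → ℕ → S → ℝ}
  {m : Fin J → S → ℕ} {z : Fin J → ℕ → S → ℕ} {n : Fin J → ℕ}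

lemma IsModel.measure_labels_eq_lintegral (h : IsModel P r c B₀ atom θ m z)
    (l : DataPoint n → ℕ) :
    P {s | (∀ j, m j s = n j) ∧ ∀ a : DataPoint n, z a.1 a.2 s = l a} =
      ∫⁻ s, (∏ j, poissonMeasure (∑' k, θ j k s).toNNReal {n j}) *
        ∏ a : DataPoint n, categorical (fun k => θ a.1 k s) {l a} ∂P := by
  let ι : DataPoint n ↪ Fin J × ℕ := ⟨fun a => (a.1, a.2), by
    rintro ⟨j, i⟩ ⟨j', i'⟩ hab
    obtain ⟨rfl, hi⟩ : j = j' ∧ (i : ℕ) = i' := Prod.mk.inj hab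
    rw [Fin.ext hi]⟩
  let A : Fin J ⊕ Fin J × ℕ → Set ℕ := Sum.elim (fun j => {n j})
    fun ji => if hi : ji.2 < n ji.1 then {l ⟨ji.1, ji.2, hi⟩} else Set.univ
  have A_label (a : DataPoint n) : A (Sum.inr (ι a)) = {l a} := dif_pos a.2.2
  have event_eq : {s | (∀ j, m j s = n j) ∧ ∀ a : DataPoint n, z a.1 a.2 s = l a} =
      {s | ((fun k => atom k s), fun j k => θ j k s) ∈ Set.univ ∧
        ∀ i ∈ univ.disjSum (univ.map ι), Sum.elim m (fun ji => z ji.1 ji.2) i s ∈ A i} := by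
    ext s
    simp only [Set.mem_ofPred_eq, Set.mem_univ, true_and, Sum.forall, inl_mem_disjSum,
      inr_mem_disjSum, mem_univ, forall_const, Finset.mem_map, forall_exists_index,
      forall_apply_eq_imp_iff, A_label]
    rfl
  rw [event_eq, h.data _ _ _ MeasurableSet.univ fun _ => MeasurableSet.of_discrete,
    Set.preimage_univ, Measure.restrict_univ]
  refine lintegral_congr fun s => ?_
  rw [prod_disjSum, prod_map]
  simp only [A_label]
  rfl

variable [IsProbabilityMeasure P]

lemma IsModel.lintegral_tprod_poissonMeasure (h : IsModel P r c B₀ atom θ m z)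
    (hr : ∀ j, 0 < r j) (q : ℕ → Fin J → ℕ) :
    ∫⁻ s, ∏' k, ∏ j, poissonMeasure (θ j k s).toNNReal {q k j} ∂P =
      ∫⁻ s, ∏' k, ∏ j, ∫⁻ t, poissonMeasure t.toNNReal {q k j}
        ∂gammaMeasure (r j) ((1 - (atom k s).1) / (atom k s).1) ∂P := by
  refine h.gamma_process.lintegral_tprod h.measurable_atoms
    (fun jk => h.measurable_weight jk.1 jk.2) (fun jk => measurable_gammaMeasure_atom _ _) ?_
    (u := fun jk t => poissonMeasure t.toNNReal {q jk.2 jk.1})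
    (fun _ => measurable_poissonMeasure_toNNReal_singleton _) fun _ _ => prob_le_one
  filter_upwards [h.ae_mem_Ioo] with s hs jk
  have := isProbabilityMeasure_gammaMeasure (hr jk.1)
    (div_pos (sub_pos.2 (hs jk.2).2) (hs jk.2).1)
  exact prob_le_one

variable [IsFiniteMeasure B₀]

lemma IsModel.measure_labels (h : IsModel P r c B₀ atom θ m z) (hc : 0 < c)
    (hr : ∀ j, 0 < r j) (l : DataPoint n → ℕ) :
    P {s | (∀ j, m j s = n j) ∧ ∀ a : DataPoint n, z a.1 a.2 s = l a} =
      (∏ j, ENNReal.ofReal (1 / (n j).factorial)) *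
        ∫⁻ s, (∏ k ∈ univ.image l, ENNReal.ofReal
            (groupWeight r (fiberSizes l k) * (atom k s).1 ^ (∑ j, fiberSizes l k j))) *
          ∏' k, ENNReal.ofReal ((1 - (atom k s).1) ^ ∑ j, r j) ∂P := by
  have factorial_ne_top : ∏ k ∈ univ.image l, ∏ j, ((fiberSizes l k j).factorial : ℝ≥0∞) ≠ ⊤ :=
    ENNReal.prod_ne_top fun k _ => ENNReal.prod_ne_top fun j _ => ENNReal.natCast_ne_top _
  calc P {s | (∀ j, m j s = n j) ∧ ∀ a : DataPoint n, z a.1 a.2 s = l a}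
      = ∫⁻ s, (∏ j, ENNReal.ofReal (1 / (n j).factorial)) *
          ((∏ k ∈ univ.image l, ∏ j, ((fiberSizes l k j).factorial : ℝ≥0∞)) *
            ∏' k, ∏ j, poissonMeasure (θ j k s).toNNReal {fiberSizes l k j}) ∂P := by
        rw [h.measure_labels_eq_lintegral l]
        refine lintegral_congr_ae ?_
        filter_upwards [h.ae_weight_nonneg, h.ae_summable hc hr] with s hs hsum
          using prod_poissonMeasure_mul_prod_categorical hs hsum l
    _ = (∏ j, ENNReal.ofReal (1 / (n j).factorial)) *
          ∫⁻ s, (∏ k ∈ univ.image l, ∏ j, ((fiberSizes l k j).factorial : ℝ≥0∞)) *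
            ∏' k, ∏ j, ∫⁻ t, poissonMeasure t.toNNReal {fiberSizes l k j}
              ∂gammaMeasure (r j) ((1 - (atom k s).1) / (atom k s).1) ∂P := by
        rw [lintegral_const_mul' _ _ (ENNReal.prod_ne_top fun j _ => ENNReal.ofReal_ne_top),
          lintegral_const_mul' _ _ factorial_ne_top, lintegral_const_mul' _ _ factorial_ne_top,
          h.lintegral_tprod_poissonMeasure hr]
    _ = _ := by
        refine congrArg _ (lintegral_congr_ae ?_)
        filter_upwards [h.ae_mem_Ioo] with s hs
          using prod_factorial_mul_tprod_lintegral_gammaMeasure hr hs l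

end Labelling

/-! ### The joint law of the group sizes and the partition -/

section Partition

variable {S Ω : Type*} [MeasurableSpace S] [MeasurableSpace Ω] {J : ℕ} {P : Measure S}
  {r : Fin J → ℝ} {c : ℝ} {B₀ : Measure Ω} {atom : ℕ → S → ℝ × Ω} {θ : Fin J → ℕ → S → ℝ}
  {m : Fin J → S → ℕ} {z : Fin J → ℕ → S → ℕ} {n : Fin J → ℕ}

lemma measurableSet_clusters_eq (hz : ∀ j i, Measurable (z j i))
    (π : Finpartition (univ : Finset (DataPoint n))) :
    MeasurableSet {s | clusters n (fun a => z a.1 a.2 s) = π} :=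
  (measurable_pi_iff.2 fun a : DataPoint n => hz a.1 a.2)
    (MeasurableSet.of_discrete (s := {l | clusters n l = π}))

lemma measurableSet_sizes_eq (hm : ∀ j, Measurable (m j)) (n : Fin J → ℕ) :
    MeasurableSet {s | ∀ j, m j s = n j} := by
  rw [Set.ofPred_forall]
  exact MeasurableSet.iInter fun j => hm j (measurableSet_singleton _)

lemma IsModel.measure_clusters_eq_tsum (h : IsModel P r c B₀ atom θ m z)
    (π : Finpartition (univ : Finset (DataPoint n))) :
    P {s | (∀ j, m j s = n j) ∧ clusters n (fun a => z a.1 a.2 s) = π} =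
      ∑' e : π.parts ↪ ℕ,
        P {s | (∀ j, m j s = n j) ∧ ∀ a : DataPoint n, z a.1 a.2 s = labelOf π e a} := by
  have : Countable (π.parts ↪ ℕ) := Function.Embedding.coe_injective.countable
  have measurableSet_labels_eq (l : DataPoint n → ℕ) :
      MeasurableSet {s | ∀ a : DataPoint n, z a.1 a.2 s = l a} := by
    rw [Set.ofPred_forall]
    exact MeasurableSet.iInter fun a => h.measurable_label _ _ (measurableSet_singleton _)
  have event_eq : {s | (∀ j, m j s = n j) ∧ clusters n (fun a => z a.1 a.2 s) = π} =
      ⋃ e : π.parts ↪ ℕ,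
        {s | (∀ j, m j s = n j) ∧ ∀ a : DataPoint n, z a.1 a.2 s = labelOf π e a} := by
    ext s
    simp only [Set.mem_iUnion, Set.mem_ofPred_eq, exists_and_left]
    refine and_congr_right fun _ => ⟨fun hπ => ?_, ?_⟩
    · obtain ⟨e, he⟩ := (labelEquiv π ℕ).surjective ⟨_, hπ⟩
      exact ⟨e, fun a => (congrFun (congrArg Subtype.val he) a).symm⟩
    · rintro ⟨e, he⟩
      rw [funext he]
      exact kerPartition_labelOf π e
  rw [event_eq, measure_iUnion]
  · refine fun e e' hne => Set.disjoint_left.2 fun s hs hs' => hne ?_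
    refine (labelEquiv π ℕ).injective (Subtype.ext (funext fun a => ?_))
    exact (hs.2 a).symm.trans (hs'.2 a)
  · exact fun e => (measurableSet_sizes_eq h.measurable_size n).inter (measurableSet_labels_eq _)

lemma columnTotalWeight_eq_beta (r : Fin J → ℝ) (c : ℝ) (v : Fin J → ℕ) :
    columnTotalWeight r c v = beta ((∑ j, v j : ℕ) : ℝ) (c + ∑ j, r j) := by
  rw [columnTotalWeight, beta, Nat.cast_sum]
  ring_nf

variable [IsFiniteMeasure B₀]

lemma lintegral_betaLevy_groupWeight_mul (hr : ∀ j, 0 < r j) {v : Fin J → ℕ}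
    (hv : 1 ≤ ∑ j, v j) {ρ : ℝ} (hρ : 0 < c + ρ) :
    ∫⁻ y, ENNReal.ofReal (groupWeight r v * y.1 ^ (∑ j, v j)) *
        ENNReal.ofReal ((1 - y.1) ^ ρ) ∂betaLevy c B₀ =
      ENNReal.ofReal (B₀.real Set.univ *
        (beta ((∑ j, v j : ℕ) : ℝ) (c + ρ) * groupWeight r v)) := by
  have weight_nonneg : 0 ≤ groupWeight r v := (groupWeight_pos hr v).le
  calc ∫⁻ y, ENNReal.ofReal (groupWeight r v * y.1 ^ (∑ j, v j)) *
        ENNReal.ofReal ((1 - y.1) ^ ρ) ∂betaLevy c B₀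
      = ∫⁻ y, ENNReal.ofReal (groupWeight r v) *
          ENNReal.ofReal (y.1 ^ (∑ j, v j) * (1 - y.1) ^ ρ) ∂betaLevy c B₀ := by
        refine lintegral_congr_ae ?_
        filter_upwards [ae_betaLevy_mem_Ioo] with y hy
        have := hy.1
        rw [← ENNReal.ofReal_mul weight_nonneg, ← ENNReal.ofReal_mul (by positivity), mul_assoc]
    _ = ENNReal.ofReal (groupWeight r v) *
          (B₀ Set.univ * ENNReal.ofReal (beta ((∑ j, v j : ℕ) : ℝ) (c + ρ))) := by
        rw [lintegral_const_mul _ (by fun_prop), lintegral_betaLevy_pow_mul_rpow hρ hv]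
    _ = _ := by
        rw [← ofReal_measureReal (measure_ne_top _ _), ← ENNReal.ofReal_mul measureReal_nonneg,
          ← ENNReal.ofReal_mul weight_nonneg]
        ring_nf

lemma lintegral_betaLevy_groupWeight_ne_top (hc : 0 < c) (hr : ∀ j, 0 < r j) {v : Fin J → ℕ}
    (hv : 1 ≤ ∑ j, v j) :
    ∫⁻ y, ENNReal.ofReal (groupWeight r v * y.1 ^ (∑ j, v j)) ∂betaLevy c B₀ ≠ ⊤ := by
  have lintegral_eq := lintegral_betaLevy_groupWeight_mul (B₀ := B₀) hr hv
    (by simpa using hc : 0 < c + 0)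
  simp only [Real.rpow_zero, ENNReal.ofReal_one, mul_one] at lintegral_eq
  exact lintegral_eq.trans_ne ENNReal.ofReal_ne_top

lemma lintegral_betaLevy_one_sub_ofReal_rpow (hc : 0 < c) {ρ : ℝ} (hρ : 0 ≤ ρ) :
    ∫⁻ y, (1 - ENNReal.ofReal ((1 - y.1) ^ ρ)) ∂betaLevy c B₀ =
      ENNReal.ofReal (B₀.real Set.univ * (digamma (c + ρ) - digamma c)) := by
  rw [ENNReal.ofReal_mul measureReal_nonneg, ofReal_measureReal,
    ← lintegral_betaLevy_one_sub_rpow hc hρ]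
  refine lintegral_congr_ae ?_
  filter_upwards [ae_betaLevy_mem_Ioo] with y hy
  rw [ENNReal.ofReal_sub _ (Real.rpow_nonneg (sub_nonneg.2 hy.2.le) _), ENNReal.ofReal_one]

variable [IsProbabilityMeasure P]

lemma IsModel.tsum_lintegral_embedding (h : IsModel P r c B₀ atom θ m z) (hc : 0 < c)
    (hr : ∀ j, 0 < r j) (π : Finpartition (univ : Finset (DataPoint n))) :
    ∑' e : π.parts ↪ ℕ, ∫⁻ s, (∏ A, ENNReal.ofReal
          (groupWeight r (clusterSize A.1) * (atom (e A) s).1 ^ (∑ j, clusterSize A.1 j))) *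
        ∏' k, ENNReal.ofReal ((1 - (atom k s).1) ^ ∑ j, r j) ∂P =
      (∏ A : π.parts, ENNReal.ofReal (B₀.real Set.univ * clusterWeight r c (clusterSize A.1))) *
        ENNReal.ofReal
          (Real.exp (-(B₀.real Set.univ * (digamma (c + ∑ j, r j) - digamma c)))) := by
  have : Countable (π.parts ↪ ℕ) := Function.Embedding.coe_injective.countable
  have sum_r_nonneg : 0 ≤ ∑ j, r j := sum_nonneg fun j _ => (hr j).le
  let f (A : π.parts) (y : ℝ × Ω) : ℝ≥0∞ := ENNReal.ofReal
    (groupWeight r (clusterSize A.1) * y.1 ^ (∑ j, clusterSize A.1 j))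
  let φ (y : ℝ × Ω) : ℝ≥0∞ := 1 - ENNReal.ofReal ((1 - y.1) ^ ∑ j, r j)
  have measurable_f (A : π.parts) : Measurable (f A) := by fun_prop
  have measurable_φ : Measurable φ := by fun_prop
  have one_sub_φ {y : ℝ × Ω} (hy : y.1 ∈ Set.Ioo (0 : ℝ) 1) :
      1 - φ y = ENNReal.ofReal ((1 - y.1) ^ ∑ j, r j) :=
    ENNReal.sub_sub_cancel ENNReal.one_ne_top (ofReal_one_sub_rpow_le_one hy sum_r_nonneg)
  have lintegral_f_mul (A : π.parts) : ∫⁻ y, f A y * (1 - φ y) ∂betaLevy c B₀ =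
      ENNReal.ofReal (B₀.real Set.univ * clusterWeight r c (clusterSize A.1)) := by
    rw [clusterWeight, columnTotalWeight_eq_beta,
      ← lintegral_betaLevy_groupWeight_mul hr (one_le_sum_clusterSize A.2) (by linarith)]
    refine lintegral_congr_ae ?_
    filter_upwards [ae_betaLevy_mem_Ioo] with y hy
    rw [one_sub_φ hy]
  have lintegral_φ := lintegral_betaLevy_one_sub_ofReal_rpow (B₀ := B₀) hc sum_r_nonneg
  have digamma_le : digamma c ≤ digamma (c + ∑ j, r j) :=
    monotoneOn_digamma hc (add_pos_of_pos_of_nonneg hc sum_r_nonneg)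
      (le_add_of_nonneg_right sum_r_nonneg)
  calc _ = ∑' e : π.parts ↪ ℕ, ∫⁻ s, (∏ A, f A (atom (e A) s)) *
          ∏' k, (1 - φ (atom k s)) ∂P := by
        refine tsum_congr fun e => lintegral_congr_ae ?_
        filter_upwards [h.ae_mem_Ioo] with s hs
        simp only [one_sub_φ (hs _), f]
    _ = ∫⁻ s, (∑' e : π.parts ↪ ℕ, ∏ A, f A (atom (e A) s)) *
          ∏' k, (1 - φ (atom k s)) ∂P := by
        simp only [← ENNReal.tsum_mul_right]
        refine (lintegral_tsum fun e => ?_).symm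
        have measurable_atom := h.beta_process.measurable
        exact ((Finset.measurable_prod _ fun A _ =>
          (measurable_f A).comp (measurable_atom _)).mul <| measurable_tprod
            (fun k => (measurable_φ.comp (measurable_atom k)).const_sub 1)
            fun _ _ => tsub_le_self).aemeasurable
    _ = _ := by
        rw [h.beta_process.lintegral_tsum_embedding_mul_tprod measurable_f (by simp [f])
          (fun A => lintegral_betaLevy_groupWeight_ne_top hc hr (one_le_sum_clusterSize A.2))
          measurable_φ (fun y => tsub_le_self)
          (lintegral_φ.trans_ne ENNReal.ofReal_ne_top), lintegral_φ, ENNReal.toReal_ofReal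
            (mul_nonneg measureReal_nonneg (sub_nonneg.2 digamma_le))]
        simp only [lintegral_f_mul]

lemma IsModel.measure_clusters (h : IsModel P r c B₀ atom θ m z) (hc : 0 < c)
    (hr : ∀ j, 0 < r j) (π : Finpartition (univ : Finset (DataPoint n))) :
    P {s | (∀ j, m j s = n j) ∧ clusters n (fun a => z a.1 a.2 s) = π} =
      ENNReal.ofReal (Real.exp (-(B₀.real Set.univ * (digamma (c + ∑ j, r j) - digamma c))) *
        eppfNumerator r c (B₀.real Set.univ) n π) := by
  have factor_nonneg (A : π.parts) :
      0 ≤ B₀.real Set.univ * clusterWeight r c (clusterSize A.1) :=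
    mul_nonneg measureReal_nonneg <| mul_nonneg
      (columnTotalWeight_pos hc hr (one_le_sum_clusterSize A.2)).le (groupWeight_pos hr _).le
  have measure_labels (e : π.parts ↪ ℕ) := h.measure_labels hc hr (labelOf π e)
  have prod_image (e : π.parts ↪ ℕ) (s : S) := prod_image_labelOf π e fun k v =>
    ENNReal.ofReal (groupWeight r v * (atom k s).1 ^ ∑ j, v j)
  simp only [prod_image] at measure_labels
  rw [h.measure_clusters_eq_tsum π]
  simp only [measure_labels]
  rw [ENNReal.tsum_mul_left, h.tsum_lintegral_embedding hc hr π,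
    ← ENNReal.ofReal_prod_of_nonneg fun j _ => by positivity,
    ← ENNReal.ofReal_prod_of_nonneg fun A _ => factor_nonneg A,
    ← ENNReal.ofReal_mul (prod_nonneg fun A _ => factor_nonneg A),
    ← ENNReal.ofReal_mul (prod_nonneg fun j _ => by positivity),
    eppfNumerator_eq_prod_clusterWeight]
  congr 1
  rw [prod_mul_distrib, prod_const, card_univ, Fintype.card_coe,
    prod_coe_sort π.parts fun A => clusterWeight r c (clusterSize A)]
  simp only [one_div, Finset.prod_inv_distrib]
  ring

lemma IsModel.measureReal_sizes_inter_clusters (h : IsModel P r c B₀ atom θ m z) (hc : 0 < c)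
    (hr : ∀ j, 0 < r j) (π : Finpartition (univ : Finset (DataPoint n))) :
    P.real ({s | ∀ j, m j s = n j} ∩ {s | clusters n (fun a => z a.1 a.2 s) = π}) =
      Real.exp (-(B₀.real Set.univ * (digamma (c + ∑ j, r j) - digamma c))) *
        eppfNumerator r c (B₀.real Set.univ) n π := by
  have numerator_nonneg : 0 ≤ eppfNumerator r c (B₀.real Set.univ) n π :=
    eppfNumerator_nonneg hc hr measureReal_nonneg π
  rw [← ENNReal.toReal_ofReal (mul_nonneg (Real.exp_nonneg _) numerator_nonneg),
    ← h.measure_clusters hc hr π]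
  rfl

theorem IsModel.measureReal_sizes (h : IsModel P r c B₀ atom θ m z) (hc : 0 < c)
    (hr : ∀ j, 0 < r j) (hn : 1 ≤ ∑ j, n j) :
    P.real {s | ∀ j, m j s = n j} =
      Real.exp (-(B₀.real Set.univ * (digamma (c + ∑ j, r j) - digamma c))) *
        eppfDenominator r c (B₀.real Set.univ) n := by
  rw [← sum_eppfNumerator r c _ hn, mul_sum,
    ← sum_congr rfl fun π _ => h.measureReal_sizes_inter_clusters hc hr π,
    ← measureReal_biUnion_finset]
  · congr 1
    ext s
    simp
  · intro π _ π' _ hne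
    exact Set.disjoint_left.2 fun s hs hs' => hne (hs.2.symm.trans hs'.2)
  · exact fun π _ => (measurableSet_sizes_eq h.measurable_size n).inter
      (measurableSet_clusters_eq h.measurable_label π)

theorem IsModel.cond_clusters (h : IsModel P r c B₀ atom θ m z) (hc : 0 < c)
    (hr : ∀ j, 0 < r j) (hn : 1 ≤ ∑ j, n j)
    (π : Finpartition (univ : Finset (DataPoint n))) :
    (P[|{s | ∀ j, m j s = n j}]).real {s | clusters n (fun a => z a.1 a.2 s) = π} =
      eppfNumerator r c (B₀.real Set.univ) n π / eppfDenominator r c (B₀.real Set.univ) n := by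
  rw [measureReal_def, cond_apply (measurableSet_sizes_eq h.measurable_size n),
    ENNReal.toReal_mul, ENNReal.toReal_inv, ← measureReal_def, ← measureReal_def,
    h.measureReal_sizes_inter_clusters hc hr, h.measureReal_sizes hc hr hn, inv_mul_eq_div,
    mul_div_mul_left _ _ (Real.exp_ne_zero _)]

end Partition

end BNBP

end

theorem lemma3_general {S Ω : Type*} [MeasurableSpace S] (P : Measure S) [IsProbabilityMeasure P]
    [MeasurableSpace Ω] (B₀ : Measure Ω) [IsFiniteMeasure B₀] (hB₀ : B₀ ≠ 0)
    (c : ℝ) (hc : 0 < c) {J : ℕ} (r : Fin J → ℝ) (hr : ∀ j, 0 < r j)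
    (atom : ℕ → S → ℝ × Ω) (θ : Fin J → ℕ → S → ℝ) (m : Fin J → S → ℕ)
    (z : Fin J → ℕ → S → ℕ) (model : BNBP.IsModel P r c B₀ atom θ m z)
    (n : Fin J → ℕ) (hn : 1 ≤ ∑ j, n j) :
    0 < P.real {s | ∀ j, m j s = n j} ∧
    P.real {s | ∀ j, m j s = n j} =
      Real.exp (-(B₀.real Set.univ *
        (BNBP.digamma (c + ∑ j, r j) - BNBP.digamma c))) *
        BNBP.eppfDenominator r c (B₀.real Set.univ) n ∧
    (∀ π : Finpartition (Finset.univ : Finset (BNBP.DataPoint n)),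
      (P[|{s | ∀ j, m j s = n j}]).real
          {s | BNBP.clusters n (fun x => z x.1 x.2 s) = π} =
        BNBP.eppfNumerator r c (B₀.real Set.univ) n π /
          BNBP.eppfDenominator r c (B₀.real Set.univ) n) ∧
    (∀ π π' : Finpartition (Finset.univ : Finset (BNBP.DataPoint n)),
      π.parts.val.map BNBP.clusterSize = π'.parts.val.map BNBP.clusterSize →
      (P[|{s | ∀ j, m j s = n j}]).real
          {s | BNBP.clusters n (fun x => z x.1 x.2 s) = π} =
        (P[|{s | ∀ j, m j s = n j}]).real
          {s | BNBP.clusters n (fun x => z x.1 x.2 s) = π'}) := by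
  have mass_pos : 0 < B₀.real Set.univ :=
    ENNReal.toReal_pos (Measure.measure_univ_ne_zero.2 hB₀) (measure_ne_top _ _)
  have sizes_eq := model.measureReal_sizes hc hr hn
  have cond_eq := model.cond_clusters hc hr hn
  refine ⟨?_, sizes_eq, cond_eq, fun π π' h => ?_⟩
  · rw [sizes_eq]
    exact mul_pos (Real.exp_pos _) (BNBP.eppfDenominator_pos hc hr mass_pos hn)
  · rw [cond_eq, cond_eq, BNBP.eppfNumerator_congr r c _ h]

theorem lemma3 {S Ω : Type*} [MeasurableSpace S] (P : Measure S) [IsProbabilityMeasure P]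
    [MetricSpace Ω] [CompleteSpace Ω] [TopologicalSpace.SeparableSpace Ω]
    [MeasurableSpace Ω] [BorelSpace Ω]
    (B₀ : Measure Ω) [IsFiniteMeasure B₀] [NullSingletonClass B₀] (hB₀ : B₀ ≠ 0)
    (c : ℝ) (hc : 0 < c) {J : ℕ} (r : Fin J → ℝ) (hr : ∀ j, 0 < r j)
    (atom : ℕ → S → ℝ × Ω) (θ : Fin J → ℕ → S → ℝ) (m : Fin J → S → ℕ)
    (z : Fin J → ℕ → S → ℕ) (model : BNBP.IsModel P r c B₀ atom θ m z)
    (n : Fin J → ℕ) (hn : 1 ≤ ∑ j, n j) :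
    -- the marginal probability mass function of the group sizes
    0 < P.real {s | ∀ j, m j s = n j} ∧
    P.real {s | ∀ j, m j s = n j} =
      Real.exp (-(B₀.real Set.univ *
        (BNBP.digamma (c + ∑ j, r j) - BNBP.digamma c))) *
        BNBP.eppfDenominator r c (B₀.real Set.univ) n ∧
    -- the conditional distribution of the partition given the group sizes
    (∀ π : Finpartition (Finset.univ : Finset (BNBP.DataPoint n)),
      (P[|{s | ∀ j, m j s = n j}]).real
          {s | BNBP.clusters n (fun x => z x.1 x.2 s) = π} =
        BNBP.eppfNumerator r c (B₀.real Set.univ) n π /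
          BNBP.eppfDenominator r c (B₀.real Set.univ) n) ∧
    -- it depends only on the collection of the cluster sizes
    (∀ π π' : Finpartition (Finset.univ : Finset (BNBP.DataPoint n)),
      π.parts.val.map BNBP.clusterSize = π'.parts.val.map BNBP.clusterSize →
      (P[|{s | ∀ j, m j s = n j}]).real
          {s | BNBP.clusters n (fun x => z x.1 x.2 s) = π} =
        (P[|{s | ∀ j, m j s = n j}]).real
          {s | BNBP.clusters n (fun x => z x.1 x.2 s) = π'}) :=
  lemma3_general P B₀ hB₀ c hc r hr atom θ m z model n hn
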